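/- Let $V$ be a real vector space of dimension two (with its usual topology) and let $R\subset V^*\setminus\{0\}$ be a finite set defining a crystallographic arrangement $\mathcal A=\{\alpha^\perp\mid\alpha\in R\}$ of rank two; that is, $R\cap\mathbb R\alpha=\{\pm\alpha\}$ for all $\alpha\in R$, and for each chamber $K$ (connected component of $V\setminus\bigcup_{H\in\mathcal A}H$) there is a basis $\alpha_1,\alpha_2\in R$ of $V^*$ with $K=\{v\mid \alpha_1(v)>0,\ \alpha_2(v)>0\}$, and every such basis satisfies $R\subseteq\pm(\mathbb N_0\alpha_1+\mathbb N_0\alpha_2)$. Write $R^K=\{(u,v)\in\mathbb Z^2\mid u\alpha_1+v\alpha_2\in R\}$, ordered componentwise. Assume that $\mathcal A$ consists of at least three lines (i.e. it is not of type $A_1\times A_1$). Then there is a chamber $K$ such that $R^K$ has a unique maximal element $(x,y)$. Moreover, $K$ can be chosen such that in addition, if an $\eta$-sequence $c$ to which $\mathcal A$ is associated is not dense, then $x>u$ and $y>v$ for all $(u,v)\in R^K$ with $(u,v)\neq(x,y)$. Here $\eta$-sequences are the integer sequences obtained from $(0,0)$ by rotations, reversals and the operation $(c_1,\dots,c_n)\mapsto(c_1+1,1,c_2+1,c_3,\dots,c_n)$.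 For $1\le i<j\le n$ let $\varphi_i(j)=\varphi_j(i)$ be the lower left entry of $\eta(c_i)\cdots\eta(c_{j-1})$, where $\eta(a)=\begin{pmatrix}a&-1\\1&0\end{pmatrix}$, and let $\varphi_i(i)=0$. Let $m_i$ be the set of all $j$ at which $\varphi_i$ is maximal; $c$ is dense if for each $i$ (cyclically) $|m_i|>1$ or $|m_{i+1}|>1$. The arrangement $\mathcal A$ is associated to $c$ if for some chamber $K$, some ordering of its basis and some $i$ one has $R^K=\pm\{(\varphi_i(j),\varphi_{i+1}(j))\mid j=1,\dots,n\}$ (with $n+1$ read as $1$). -/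

import Mathlib

/-! ### Sequences attached to triangulated polygons -/

/-- The matrix `η(a)`. -/
def eta (a : ℤ) : Matrix (Fin 2) (Fin 2) ℤ := !![a, -1; 1, 0]

/-- `η`-sequences, generated from `(0,0)` by rotations, reflections and the insertion of ears. -/
inductive IsEtaSeq : List ℤ → Prop
  | base : IsEtaSeq [0, 0]
  | rotate (a : ℤ) (l : List ℤ) : IsEtaSeq (a :: l) → IsEtaSeq (l ++ [a])
  | reflect (l : List ℤ) : IsEtaSeq l → IsEtaSeq l.reverse
  | ear (a b : ℤ) (l : List ℤ) :
      IsEtaSeq (a :: b :: l) → IsEtaSeq ((a + 1) :: 1 :: (b + 1) :: l)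

/-- The product `η(c_i) ⋯ η(c_{j-1})`, for `i ≤ j`; positions are counted from `0`. -/
def etaProd (c : List ℤ) (i j : ℕ) : Matrix (Fin 2) (Fin 2) ℤ :=
  (((c.drop i).take (j - i)).map eta).prod

/-- The number `φ_i(j)`, for positions `i, j < c.length`. -/
def phi (c : List ℤ) (i j : ℕ) : ℤ :=
  if j = i then 0
  else if i < j then etaProd c i j 1 0
  else etaProd c j i 1 0

/-- The set `m_i` of positions at which `φ_i` is maximal. -/
def maxSet (c : List ℤ) (i : ℕ) : Finset ℕ :=
  {j ∈ Finset.range c.length | ∀ l ∈ Finset.range c.length, phi c i l ≤ phi c i j}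

/-- `c` is dense if of any two cyclically neighbouring `m_i`, `m_{i+1}`, at least one has more
than one element. -/
def IsDense (c : List ℤ) : Prop :=
  ∀ i < c.length, 1 < (maxSet c i).card ∨ 1 < (maxSet c ((i + 1) % c.length)).card

/-- The positive roots `(φ_i(j), φ_{i+1}(j))` belonging to the edge `(i, i+1)` of the polygon. -/
def edgeRoots (c : List ℤ) (i : ℕ) : Set (Fin 2 → ℤ) :=
  {x | ∃ j < c.length, x = ![phi c i j, phi c ((i + 1) % c.length) j]}

/-! ### Finite crystallographic arrangements -/

section Arrangement

variable {V : Type*} [NormedAddCommGroup V] [NormedSpace ℝ V]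

/-- The set of hyperplanes `α^⊥`, for `α ∈ R`. -/
def hyperplanes (R : Set (Module.Dual ℝ V)) : Set (Submodule ℝ V) :=
  {H | ∃ α ∈ R, H = LinearMap.ker α}

/-- The complement in `V` of the union of the hyperplanes `α^⊥`, for `α ∈ R`. -/
def hyperplaneCompl (R : Set (Module.Dual ℝ V)) : Set V :=
  {v | ∀ H ∈ hyperplanes R, v ∉ H}

/-- The chambers: the connected components of the complement of the hyperplanes. -/
def IsChamber (R : Set (Module.Dual ℝ V)) (K : Set V) : Prop :=
  ∃ x ∈ hyperplaneCompl R, K = connectedComponentIn (hyperplaneCompl R) x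

/-- `α` is a basis of the dual space which consists of elements of `R`, and `K` is the open
simplicial cone where all elements of `α` are positive. -/
def IsBasisAt {r : ℕ} (R : Set (Module.Dual ℝ V)) (K : Set V)
    (α : Module.Basis (Fin r) ℝ (Module.Dual ℝ V)) : Prop :=
  (∀ i, α i ∈ R) ∧ K = {v | ∀ i, 0 < α i v}

/-- `R` defines a finite crystallographic arrangement of rank `r` in `V` (with Tits cone `V`);
the underlying set of hyperplanes is `hyperplanes R`. -/
structure IsCrystallographic (r : ℕ) (R : Set (Module.Dual ℝ V)) : Prop where
  finrank_eq : Module.finrank ℝ V = r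
  finite : R.Finite
  zero_notMem : 0 ∉ R
  inter_span : ∀ α ∈ R, R ∩ (Submodule.span ℝ {α} : Set (Module.Dual ℝ V)) = {α, -α}
  /-- Every chamber is an open simplicial cone whose walls belong to the arrangement. -/
  simplicial : ∀ K, IsChamber R K →
    ∃ α : Module.Basis (Fin r) ℝ (Module.Dual ℝ V), IsBasisAt R K α
  /-- At every chamber, each root is up to a sign a combination of the basis with coefficients
  in `ℕ`. -/
  crystallographic : ∀ K, IsChamber R K →
    ∀ α : Module.Basis (Fin r) ℝ (Module.Dual ℝ V), IsBasisAt R K α →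
      ∀ β ∈ R, ∃ k : Fin r → ℕ, β = ∑ i, k i • α i ∨ β = -∑ i, k i • α i

/-- The set `R` in coordinates with respect to `α`. When `α` is the basis at a chamber `K`, this is
the root system `R^K` at `K`. -/
def rootSystemAt {r : ℕ} (R : Set (Module.Dual ℝ V))
    (α : Module.Basis (Fin r) ℝ (Module.Dual ℝ V)) : Set (Fin r → ℤ) :=
  {x | ∑ i, x i • α i ∈ R}

/-- The arrangement defined by `R` is associated to `c`: the root system at some chamber consists
of the positive roots read off at some edge of the polygon, and of their negatives. -/
def IsAssociated (c : List ℤ) (R : Set (Module.Dual ℝ V)) : Prop :=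
  ∃ (K : Set V) (α : Module.Basis (Fin 2) ℝ (Module.Dual ℝ V)),
    IsChamber R K ∧ IsBasisAt R K α ∧
    ∃ i < c.length, rootSystemAt R α = {x | x ∈ edgeRoots c i ∨ -x ∈ edgeRoots c i}

end Arrangement

/-! ### Planar root sets -/

/-! Fix the root system S at one chamber and use the determinant on ℤ². Neighbouring roots r, s have
determinant 1, and they define a chamber at which the root x has coordinates (det(r,x), det(s,x)). A
greatest element at that chamber is thus a root farthest from both r and s, and the strict form asks
that it be the only farthest root of each.

Existence: let G be the largest determinant of two roots and i a root attaining it. Among the roots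
farthest from i take w with det(r,w) maximal, r a neighbour of i. A root l farther from r than w
would make |det(w,l)| exceed G, apart from a degenerate case excluded by the third line
(`IsRootSet.exists_common_farthest`).

Strictness: a sequence that is not dense provides neighbours k, k', each with a sole farthest root.
Suppose no neighbours share a sole farthest root. If some root of width G had two farthest roots,
these three roots and their negatives would span a hexagon containing S, and k, k' would be maximal
at the same vertex (`IsRootSet.eq_of_two_farthest`). So roots of width G have sole farthest roots,
and then every second root has width G (`IsRootSet.exists_det2_next_next`). Hence k or k' has width
G, and by the existence argument they share their farthest root, a contradiction.

The link to η-sequences is a realization of the numbers φ as absolute determinants of the vectors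
`vertex c j`, which up to sign are the roots in suitable coordinates. -/

/-- The determinant of two vectors in `ℤ²`. -/
def det2 (x y : Fin 2 → ℤ) : ℤ := x 0 * y 1 - x 1 * y 0

theorem det2_swap (x y : Fin 2 → ℤ) : det2 x y = -det2 y x := by
  simp only [det2]; ring

theorem det2_self (x : Fin 2 → ℤ) : det2 x x = 0 := by
  simp only [det2]; ring

theorem det2_neg_left (x y : Fin 2 → ℤ) : det2 (-x) y = -det2 x y := by
  simp only [det2, Pi.neg_apply]; ring

theorem det2_neg_right (x y : Fin 2 → ℤ) : det2 x (-y) = -det2 x y := by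
  simp only [det2, Pi.neg_apply]; ring

theorem det2_mul_det2 (i r x y : Fin 2 → ℤ) :
    det2 i r * det2 x y = det2 i x * det2 r y - det2 r x * det2 i y := by
  simp only [det2]; ring

/-- Two vectors of determinant one such that no line through an element of `S` separates them. -/
def Adj (S : Set (Fin 2 → ℤ)) (r s : Fin 2 → ℤ) : Prop :=
  det2 r s = 1 ∧ ∀ x ∈ S, 0 ≤ det2 r x * det2 s x

/-- The properties of the root system of a crystallographic arrangement of rank two with at least
three lines that are needed to study its maximal elements. -/
structure IsRootSet (S : Set (Fin 2 → ℤ)) : Prop where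
  finite : S.Finite
  neg_mem : ∀ x ∈ S, -x ∈ S
  collinear : ∀ x ∈ S, ∀ y ∈ S, det2 x y = 0 → y = x ∨ y = -x
  nonempty : S.Nonempty
  next : ∀ r ∈ S, ∃ s ∈ S, Adj S r s
  prev : ∀ r ∈ S, ∃ s ∈ S, Adj S s r
  third : ∀ r ∈ S, ∀ s ∈ S, ∃ x ∈ S, det2 r x ≠ 0 ∧ det2 s x ≠ 0

/-- `w` is an element of `S` with the largest distance from the line spanned by `r`. -/
def Farthest (S : Set (Fin 2 → ℤ)) (r w : Fin 2 → ℤ) : Prop :=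
  w ∈ S ∧ ∀ x ∈ S, det2 r x ≤ det2 r w

/-- `w` is the only element of `S` with the largest distance from the line spanned by `r`. -/
def SoleFarthest (S : Set (Fin 2 → ℤ)) (r w : Fin 2 → ℤ) : Prop :=
  w ∈ S ∧ ∀ x ∈ S, x ≠ w → det2 r x < det2 r w

/-! ### Roots of globally maximal width -/

section

variable {S : Set (Fin 2 → ℤ)}

theorem Farthest.eq_of_sole {r w v : Fin 2 → ℤ} (hw : Farthest S r w) (hv : SoleFarthest S r v) :
    w = v := by
  by_contra h
  exact absurd (hv.2 w hw.1 h) (not_lt.2 (hw.2 v hv.1))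

theorem Farthest.exists_ne {r w : Fin 2 → ℤ} (hw : Farthest S r w) (h : ¬ SoleFarthest S r w) :
    ∃ v ∈ S, v ≠ w ∧ det2 r v = det2 r w := by
  by_contra! hc
  exact h ⟨hw.1, fun x hx hxw => lt_of_le_of_ne (hw.2 x hx) (hc x hx hxw)⟩

theorem IsRootSet.exists_max (hS : IsRootSet S) :
    ∃ G : ℤ, 0 < G ∧ (∀ x ∈ S, ∀ y ∈ S, det2 x y ≤ G) ∧ ∃ i ∈ S, ∃ j ∈ S, det2 i j = G := by
  obtain ⟨i, hi⟩ := hS.nonempty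
  obtain ⟨⟨a, b⟩, hab, hmax⟩ := (hS.finite.prod hS.finite).exists_maximalFor
    (fun z : (Fin 2 → ℤ) × (Fin 2 → ℤ) => det2 z.1 z.2) _ ⟨(i, i), hi, hi⟩
  have hle : ∀ x ∈ S, ∀ y ∈ S, det2 x y ≤ det2 a b := by
    intro x hx y hy
    rcases le_total (det2 x y) (det2 a b) with h | h
    · exact h
    · exact hmax (j := (x, y)) ⟨hx, hy⟩ h
  obtain ⟨s, hs, h1, -⟩ := hS.next i hi
  exact ⟨det2 a b, by have := hle i hi s hs; omega, hle, a, hab.1, b, hab.2, rfl⟩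

/-- Two neighbouring roots, the first one of globally maximal width, have a common farthest
root. -/
theorem IsRootSet.exists_common_farthest (hS : IsRootSet S) {G : ℤ}
    (hG : ∀ x ∈ S, ∀ y ∈ S, det2 x y ≤ G) {i j r : Fin 2 → ℤ} (hi : i ∈ S) (hj : j ∈ S)
    (hij : det2 i j = G) (hr : r ∈ S) (hir : Adj S i r ∨ Adj S r i) :
    ∃ w, Farthest S i w ∧ Farthest S r w := by
  obtain ⟨hd, hc⟩ : (det2 i r = 1 ∨ det2 i r = -1) ∧ ∀ x ∈ S, 0 ≤ det2 i x * det2 r x := by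
    rcases hir with h | h
    · exact ⟨Or.inl h.1, h.2⟩
    · exact ⟨Or.inr (by rw [det2_swap, h.1]), fun x hx => by rw [mul_comm]; exact h.2 x hx⟩
  have hGpos : 0 < G := by
    rcases hd with h | h
    · have := hG i hi r hr; omega
    · have := hG r hr i hi; rw [det2_swap] at this; omega
  -- Ties among the roots farthest from `i` are broken in favour of the largest distance from `r`.
  obtain ⟨w, ⟨hwS, hwG⟩, hmax⟩ := (hS.finite.subset (s := S) (t := {x | x ∈ S ∧ det2 i x = G})
    (fun x hx => hx.1)).exists_maximalFor (fun x => det2 r x) _ ⟨j, hj, hij⟩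
  have hmax' : ∀ x ∈ S, det2 i x = G → det2 r x ≤ det2 r w := by
    intro x hx hxG
    rcases le_total (det2 r x) (det2 r w) with h | h
    · exact h
    · exact hmax (j := x) ⟨hx, hxG⟩ h
  refine ⟨w, ⟨hwS, fun x hx => hwG ▸ hG i hi x hx⟩, hwS, fun l hl => ?_⟩
  by_contra! hlt
  have hP' : 0 ≤ det2 r w := by
    have := hc w hwS
    rw [hwG] at this
    exact nonneg_of_mul_nonneg_right this hGpos
  have hQ : det2 i l < G := by
    refine lt_of_le_of_ne (hG i hi l hl) fun h => ?_
    have := hmax' l hl h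
    omega
  have hpl : det2 i w * det2 r l - det2 r w * det2 i l ≤ G := by
    have h := det2_mul_det2 i r w l
    rcases hd with h1 | h1 <;> rw [h1] at h
    · have := hG w hwS l hl; omega
    · have := hG l hl w hwS; rw [det2_swap] at this; omega
  rw [hwG] at hpl
  -- With P = det(r,w) ≥ 0, the left side of `hpl` is at least G(P+1) − P(G−1) = G + P, so P > 0 is
  -- impossible.
  have hP0 : det2 r w = 0 := by
    by_contra hne
    have h1 : 1 ≤ det2 r w := by omega
    nlinarith [mul_le_mul_of_nonneg_left (show det2 r w + 1 ≤ det2 r l by omega) hGpos.le,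
      mul_le_mul_of_nonneg_left (show det2 i l ≤ G - 1 by omega) hP']
  have hG1 : G = 1 := by
    rcases hS.collinear r hr w hwS hP0 with h | h
    · rw [h] at hwG; omega
    · rw [h, det2_neg_right] at hwG; omega
  -- Now w = ±r and G = 1, so a root on the positive side of `i` has width 1 and, by the choice of
  -- `w`, is collinear with `r`. A third line contradicts this.
  obtain ⟨x, hx, hx1, hx2⟩ := hS.third i hi r hr
  have key : ∀ y ∈ S, 0 < det2 i y → det2 r y ≠ 0 → False := by
    intro y hy h1 h2
    have h3 := hmax' y hy (by have := hG i hi y hy; omega)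
    have h4 := nonneg_of_mul_nonneg_right (hc y hy) h1
    omega
  rcases lt_or_gt_of_ne hx1 with h | h
  · exact key (-x) (hS.neg_mem x hx) (by rw [det2_neg_right]; omega)
      (by rw [det2_neg_right]; omega)
  · exact key x hx h hx2

/-- If the determinant vanished, `k` would be ±`g`, but `g` attains the maximal width at two
different roots. -/
theorem SoleFarthest.det2_ne_zero {k a g y z : Fin 2 → ℤ} (hS : IsRootSet S) {G : ℤ}
    (hG : ∀ x ∈ S, ∀ y ∈ S, det2 x y ≤ G) (ha : SoleFarthest S k a) (hk : k ∈ S) (hg : g ∈ S)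
    (hy : y ∈ S) (hz : z ∈ S) (hyz : y ≠ z) (hgy : det2 g y = G) (hgz : det2 g z = G) :
    det2 k g ≠ 0 := by
  intro h
  have key : ∀ x ∈ S, det2 k x = G → x = a := by
    intro x hx hxG
    by_contra hne
    have := ha.2 x hx hne
    have := hG k hk a ha.1
    omega
  rcases hS.collinear k hk g hg h with rfl | rfl
  · exact hyz ((key y hy hgy).trans (key z hz hgz).symm)
  · rw [det2_neg_left, ← det2_neg_right] at hgy hgz
    exact hyz (neg_injective
      ((key _ (hS.neg_mem y hy) hgy).trans (key _ (hS.neg_mem z hz) hgz).symm))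

set_option linter.unusedSimpArgs false in
-- All roots satisfy |det(g,x)| ≤ G for g = i, j, l, and these inequalities cut out the hexagon with
-- vertices ±i, ±j, ±l. Which vertex maximizes det(m,·) depends only on the signs of det(m,i),
-- det(m,j), det(m,l). Neighbours `k`, `k'` have the same signs, none of them zero.
theorem IsRootSet.eq_of_hexagon (hS : IsRootSet S) {G : ℤ}
    (hG : ∀ x ∈ S, ∀ y ∈ S, det2 x y ≤ G) (hGpos : 0 < G) {i j l : Fin 2 → ℤ} (hi : i ∈ S)
    (hj : j ∈ S) (hl : l ∈ S) (hjl : det2 l j = G) (hij : det2 i j = G) (hil : det2 i l = G)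
    {k k' a b : Fin 2 → ℤ} (hk : k ∈ S) (hk' : k' ∈ S)
    (hkk : Adj S k k') (ha : SoleFarthest S k a) (hb : SoleFarthest S k' b) : a = b := by
  -- That is, l = i + j.
  have hsum : ∀ x, det2 l x = det2 i x + det2 j x := by
    intro x
    have h := det2_mul_det2 i j l x
    rw [hij, hil, det2_swap j l, hjl] at h
    exact mul_left_cancel₀ hGpos.ne' (by linarith)
  have hji : det2 j i = -G := by rw [det2_swap, hij]
  have hjl' : det2 j l = -G := by rw [det2_swap, hjl]
  have hne : ∀ x ∈ S, ∀ y ∈ S, det2 x y = G → x ≠ y := by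
    rintro x - y - h rfl
    rw [det2_self] at h
    omega
  have hbd : ∀ g ∈ S, ∀ x ∈ S, -G ≤ det2 g x ∧ det2 g x ≤ G := by
    intro g hg x hx
    have := hG _ (hS.neg_mem g hg) x hx
    rw [det2_neg_left] at this
    exact ⟨by omega, hG g hg x hx⟩
  have hnz : ∀ m ∈ S, ∀ c, SoleFarthest S m c →
      det2 m i ≠ 0 ∧ det2 m j ≠ 0 ∧ det2 m l ≠ 0 := by
    intro m hm c hc
    refine ⟨hc.det2_ne_zero hS hG hm hi hl hj (hne l hl j hj hjl) hil hij,
      hc.det2_ne_zero hS hG hm hj (hS.neg_mem i hi) (hS.neg_mem l hl)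
        (neg_injective.ne (hne i hi l hl hil)) (by rw [det2_neg_right]; omega)
        (by rw [det2_neg_right]; omega),
      hc.det2_ne_zero hS hG hm hl hj (hS.neg_mem i hi) ?_ hjl
        (by rw [det2_neg_right, det2_swap, hil, neg_neg])⟩
    rintro rfl
    rw [det2_neg_right, det2_self] at hij
    omega
  obtain ⟨n1, n2, n3⟩ := hnz k hk a ha
  obtain ⟨n1', n2', n3'⟩ := hnz k' hk' b hb
  have c1 := hkk.2 i hi
  have c2 := hkk.2 j hj
  have c3 := hkk.2 l hl
  have hkl : ∀ m, det2 m l = det2 m i + det2 m j := by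
    intro m
    rw [det2_swap, hsum, det2_swap i, det2_swap j]
    ring
  have hexp : ∀ m x, G * det2 m x = det2 m j * det2 i x - det2 m i * det2 j x := by
    intro m x
    have h := det2_mul_det2 i j m x
    rw [hij, det2_swap i m, det2_swap j m] at h
    linarith
  rw [hkl] at n3 n3' c3
  rw [hkl] at c3
  have fin : ∀ w ∈ S, (∀ m : Fin 2 → ℤ, (m = k ∨ m = k') → ∀ x ∈ S,
      det2 m j * det2 i x - det2 m i * det2 j x ≤
        det2 m j * det2 i w - det2 m i * det2 j w) → a = b := by
    intro w hw h
    have h1 : ∀ m, (m = k ∨ m = k') → Farthest S m w := by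
      intro m hm
      refine ⟨hw, fun x hx => ?_⟩
      have := h m hm x hx
      rw [← hexp, ← hexp] at this
      exact le_of_mul_le_mul_left this hGpos
    rw [← (h1 k (Or.inl rfl)).eq_of_sole ha, ← (h1 k' (Or.inr rfl)).eq_of_sole hb]
  have same : ∀ {x y : ℤ}, x ≠ 0 → y ≠ 0 → 0 ≤ x * y → (0 < x ∧ 0 < y) ∨ (x < 0 ∧ y < 0) := by
    intro x y hx hy hxy
    rcases lt_or_gt_of_ne hx with h | h
    · exact Or.inr ⟨h, lt_of_le_of_ne (nonpos_of_mul_nonneg_right hxy h) hy⟩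
    · exact Or.inl ⟨h, lt_of_le_of_ne (nonneg_of_mul_nonneg_right hxy h) hy.symm⟩
  -- Of the eight sign patterns, two contradict l = i + j. Each of the other six selects one vertex,
  -- and its maximality is a combination of two hexagon inequalities with nonnegative coefficients.
  rcases same n1 n1' c1 with ⟨p1, p1'⟩ | ⟨p1, p1'⟩ <;>
  rcases same n2 n2' c2 with ⟨p2, p2'⟩ | ⟨p2, p2'⟩ <;>
  rcases same n3 n3' c3 with ⟨p3, p3'⟩ | ⟨p3, p3'⟩
  · refine fin (l) hl fun m hm x hx => ?_
    obtain ⟨q1, q2, q3⟩ : 0 < det2 m i ∧ 0 < det2 m j ∧ 0 < det2 m i + det2 m j := by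
      rcases hm with rfl | rfl <;> exact ⟨by assumption, by assumption, by assumption⟩
    obtain ⟨u1, u2⟩ := hbd i hi x hx
    obtain ⟨v1, v2⟩ := hbd j hj x hx
    obtain ⟨t1, t2⟩ := hbd l hl x hx
    rw [hsum] at t1 t2
    simp only [det2_neg_right, det2_self, hij, hil, hji, hjl']
    linarith [mul_nonneg (sub_nonneg.2 q2.le) (sub_nonneg.2 u2), mul_nonneg (sub_nonneg.2 q1.le) (sub_nonneg.2 v1)]
  · omega
  · refine fin (i) hi fun m hm x hx => ?_
    obtain ⟨q1, q2, q3⟩ : 0 < det2 m i ∧ det2 m j < 0 ∧ 0 < det2 m i + det2 m j := by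
      rcases hm with rfl | rfl <;> exact ⟨by assumption, by assumption, by assumption⟩
    obtain ⟨u1, u2⟩ := hbd i hi x hx
    obtain ⟨v1, v2⟩ := hbd j hj x hx
    obtain ⟨t1, t2⟩ := hbd l hl x hx
    rw [hsum] at t1 t2
    simp only [det2_neg_right, det2_self, hij, hil, hji, hjl']
    linarith [mul_nonneg (sub_nonneg.2 q2.le) (sub_nonneg.2 t1), mul_nonneg (sub_nonneg.2 q3.le) (sub_nonneg.2 v1)]
  · refine fin (-j) (hS.neg_mem j hj) fun m hm x hx => ?_
    obtain ⟨q1, q2, q3⟩ : 0 < det2 m i ∧ det2 m j < 0 ∧ det2 m i + det2 m j < 0 := by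
      rcases hm with rfl | rfl <;> exact ⟨by assumption, by assumption, by assumption⟩
    obtain ⟨u1, u2⟩ := hbd i hi x hx
    obtain ⟨v1, v2⟩ := hbd j hj x hx
    obtain ⟨t1, t2⟩ := hbd l hl x hx
    rw [hsum] at t1 t2
    simp only [det2_neg_right, det2_self, hij, hil, hji, hjl']
    linarith [mul_nonneg (sub_nonneg.2 q1.le) (sub_nonneg.2 t1), mul_nonneg (sub_nonneg.2 q3.le) (sub_nonneg.2 u1)]
  · refine fin (j) hj fun m hm x hx => ?_
    obtain ⟨q1, q2, q3⟩ : det2 m i < 0 ∧ 0 < det2 m j ∧ 0 < det2 m i + det2 m j := by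
      rcases hm with rfl | rfl <;> exact ⟨by assumption, by assumption, by assumption⟩
    obtain ⟨u1, u2⟩ := hbd i hi x hx
    obtain ⟨v1, v2⟩ := hbd j hj x hx
    obtain ⟨t1, t2⟩ := hbd l hl x hx
    rw [hsum] at t1 t2
    simp only [det2_neg_right, det2_self, hij, hil, hji, hjl']
    linarith [mul_nonneg (sub_nonneg.2 q1.le) (sub_nonneg.2 t2), mul_nonneg (sub_nonneg.2 q3.le) (sub_nonneg.2 u2)]
  · refine fin (-i) (hS.neg_mem i hi) fun m hm x hx => ?_
    obtain ⟨q1, q2, q3⟩ : det2 m i < 0 ∧ 0 < det2 m j ∧ det2 m i + det2 m j < 0 := by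
      rcases hm with rfl | rfl <;> exact ⟨by assumption, by assumption, by assumption⟩
    obtain ⟨u1, u2⟩ := hbd i hi x hx
    obtain ⟨v1, v2⟩ := hbd j hj x hx
    obtain ⟨t1, t2⟩ := hbd l hl x hx
    rw [hsum] at t1 t2
    simp only [det2_neg_right, det2_self, hij, hil, hji, hjl']
    linarith [mul_nonneg (sub_nonneg.2 q2.le) (sub_nonneg.2 t2), mul_nonneg (sub_nonneg.2 q3.le) (sub_nonneg.2 v2)]
  · omega
  · refine fin (-l) (hS.neg_mem l hl) fun m hm x hx => ?_
    obtain ⟨q1, q2, q3⟩ : det2 m i < 0 ∧ det2 m j < 0 ∧ det2 m i + det2 m j < 0 := by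
      rcases hm with rfl | rfl <;> exact ⟨by assumption, by assumption, by assumption⟩
    obtain ⟨u1, u2⟩ := hbd i hi x hx
    obtain ⟨v1, v2⟩ := hbd j hj x hx
    obtain ⟨t1, t2⟩ := hbd l hl x hx
    rw [hsum] at t1 t2
    simp only [det2_neg_right, det2_self, hij, hil, hji, hjl']
    linarith [mul_nonneg (sub_nonneg.2 q2.le) (sub_nonneg.2 u1), mul_nonneg (sub_nonneg.2 q1.le) (sub_nonneg.2 v2)]

/-- If a root of globally maximal width has two farthest roots, then these three roots determine
the convex hull of all roots, and neighbouring roots with only one farthest root have it in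
common. -/
theorem IsRootSet.eq_of_two_farthest (hS : IsRootSet S) {G : ℤ}
    (hG : ∀ x ∈ S, ∀ y ∈ S, det2 x y ≤ G) (hGpos : 0 < G) {i j l : Fin 2 → ℤ} (hi : i ∈ S)
    (hj : j ∈ S) (hl : l ∈ S) (hjl : j ≠ l) (hij : det2 i j = G) (hil : det2 i l = G)
    {k k' a b : Fin 2 → ℤ} (hk : k ∈ S) (hk' : k' ∈ S)
    (hkk : Adj S k k') (ha : SoleFarthest S k a) (hb : SoleFarthest S k' b) : a = b := by
  -- Since det(i,r) = 1, the neighbour `r` shows that det(j,l) is a multiple of G. It is nonzero and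
  -- at most G in absolute value, so it is ±G.
  obtain ⟨r, hr, hir, -⟩ := hS.next i hi
  have h := det2_mul_det2 i r j l
  rw [hir, hij, hil, one_mul] at h
  have hle := hG j hj l hl
  have hle' := hG l hl j hj
  rw [det2_swap] at hle'
  have hne : det2 j l ≠ 0 := by
    intro h0
    rcases hS.collinear j hj l hl h0 with h1 | h1
    · exact hjl h1.symm
    · rw [h1, det2_neg_right] at hil
      omega
  have h2 : det2 j l = G * (det2 r l - det2 r j) := by rw [h]; ring
  have h3 : det2 r l - det2 r j ≤ 1 := by
    by_contra! hc
    nlinarith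
  have h4 : -1 ≤ det2 r l - det2 r j := by
    by_contra! hc
    nlinarith
  have h5 : det2 r l - det2 r j ≠ 0 := by
    intro h0
    rw [h0, mul_zero] at h2
    exact hne h2
  rcases (show det2 r l - det2 r j = 1 ∨ det2 r l - det2 r j = -1 by omega) with h6 | h6
  · rw [h6, mul_one] at h2
    exact hS.eq_of_hexagon hG hGpos hi hl hj h2 hil hij hk hk' hkk ha hb
  · rw [h6] at h2
    exact hS.eq_of_hexagon hG hGpos hi hj hl (by rw [det2_swap, h2]; ring) hij hil hk hk' hkk
      ha hb

end

/-! ### Propagation of maximal width to every second root -/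

section

variable {S : Set (Fin 2 → ℤ)}

/-- A root collinear with `r` is ±`r`. This turns degenerate positions into numerical constraints
for `next_next_arith`. -/
theorem IsRootSet.det2_eq_one_or (hS : IsRootSet S) {i r x : Fin 2 → ℤ} (hr : r ∈ S) (hx : x ∈ S)
    (hir : det2 i r = 1 ∨ det2 i r = -1) (h : det2 r x = 0) :
    det2 i x = 1 ∨ det2 i x = -1 := by
  rcases hS.collinear r hr x hx h with rfl | rfl
  · exact hir
  · rw [det2_neg_right]
    omega

theorem le_two_of_mul_mul_le_add {a x y : ℤ} (hx : 0 < x) (hy : 0 < y) (h : x * y * a ≤ x + y) :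
    a ≤ 2 := by
  by_contra! ha
  nlinarith [mul_pos hx hy, mul_le_mul_of_nonneg_left (show 1 ≤ y from hy) hx.le,
    mul_le_mul_of_nonneg_left (show 1 ≤ x from hx) hy.le,
    mul_le_mul_of_nonneg_left (show 3 ≤ a from ha) (mul_pos hx hy).le]

theorem eq_one_of_mul_mul_two_le_add {x y : ℤ} (hx : 0 < x) (hy : 0 < y)
    (h : x * y * 2 ≤ x + y) : x = 1 ∧ y = 1 := by
  have h1 := mul_le_mul_of_nonneg_left (show 1 ≤ y from hy) hx.le
  have h2 := mul_le_mul_of_nonneg_left (show 1 ≤ x from hx) hy.le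
  have h3 : x * y = x := by linarith
  have h4 : x * y = y := by linarith
  have h5 : y = 1 := mul_left_cancel₀ hx.ne' (by linarith)
  exact ⟨by omega, h5⟩

theorem eq_one_of_mul_pos_of_mul_lt {a G : ℤ} (hG : 0 < G) (h1 : 0 < a * G)
    (h2 : a * G < 2 * G) : a = 1 := by
  have := pos_of_mul_pos_left h1 hG.le
  have := lt_of_mul_lt_mul_right h2 hG.le
  omega

/-- The arithmetic behind `IsRootSet.exists_det2_next_next`. -/
theorem next_next_arith {a b e f G G1 G2 H1 H2 σ τ π υ c : ℤ} (hG1 : G1 = a + f)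
    (hG2 : G2 = b + e) (hH1 : H1 = a + e) (hH2 : H2 = b + f) (hG : G = a + b + e + f)
    (hdet : H2 * G1 - f * G = 1) (pG1 : 0 < G1) (pG2 : 0 < G2) (pH1 : 0 < H1) (pH2 : 0 < H2)
    (hσ : 0 < σ) (hτ : 0 < τ) (hπ : 0 < π) (hυ : 0 < υ) (c1 : σ * G1 ≤ G) (c2 : τ * G2 ≤ G)
    (c3 : π * H1 ≤ G) (c5 : π * σ * a ≤ π + σ) (c6 : υ * τ * b ≤ υ + τ)
    (n2 : G1 = τ → G - τ = 1 ∨ G - τ = -1) (n3 : π * a = 1 → π * H1 = 1 ∨ π * H1 = -1)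
    (np : G - σ = G1 → G - σ = 1 ∨ G - σ = -1)
    (nq : H1 * G1 = a * (G - σ) → G - σ = H1 ∨ G - σ = -H1)
    (sG : c ≤ G) (sjG : c * G1 - G ≤ G) (sj : 0 ≤ G1 * (c * G1 - G))
    (s3 : 0 ≤ (1 - π * a) * (c * (1 - π * a) - -(π * H1))) :
    c = G ∨ c * G1 - (G - σ) = G ∨ c * G1 - G = G := by
  have hab : a * b - e * f = 1 := by subst hG1 hH2 hG; linarith
  have hGpos : 0 < G := by omega
  -- From ab − ef = 1 follow aG = 1 + G1·H1, eG = G2·H1 − 1, and the analogous identities for b and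
  -- f.
  have ha : 0 < a := by
    by_contra! hc
    have : a * G = 1 + G1 * H1 := by subst hG1 hH1 hG; linarith
    nlinarith [mul_pos pG1 pH1]
  have hb : 0 < b := by
    by_contra! hc
    have : b * G = 1 + G2 * H2 := by subst hG2 hH2 hG; linarith
    nlinarith [mul_pos pG2 pH2]
  have he : 0 ≤ e := by
    by_contra! hc
    have : e * G = G2 * H1 - 1 := by subst hG2 hH1 hG; linarith
    nlinarith [mul_pos pG2 pH1]
  have hf : 0 ≤ f := by
    by_contra! hc
    have : f * G = G1 * H2 - 1 := by subst hG1 hH2 hG; linarith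
    nlinarith [mul_pos pG1 pH2]
  -- `c5` says a ≤ 1/π + 1/σ, so a ≤ 2, and a = 2 forces π = σ = 1. The same holds for b with υ, τ.
  have ha2 := le_two_of_mul_mul_le_add hπ hσ c5
  have hb2 := le_two_of_mul_mul_le_add hυ hτ c6
  have sj' := nonneg_of_mul_nonneg_right sj pG1
  -- The product ef = ab − 1 is 0, 1 or 3. What remains is settled by the constraints from collinear
  -- roots and the bounds on c.
  rcases (show a = 1 ∨ a = 2 by omega) with rfl | rfl <;>
    rcases (show b = 1 ∨ b = 2 by omega) with rfl | rfl
  · rcases mul_eq_zero.1 (show e * f = 0 by linarith) with rfl | rfl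
    · rcases eq_or_lt_of_le hf with rfl | hf'
      · have hG' : G = 2 := by omega
        subst hG1 hG'
        omega
      · have hσ1 : σ = 1 := by
          by_contra hc
          linarith [mul_le_mul_of_nonneg_right (show 2 ≤ σ by omega) pG1.le]
        omega
    · have hG' : G = 2 := by
        rcases eq_or_ne τ 1 with h | h
        · omega
        · linarith [mul_le_mul_of_nonneg_right (show 2 ≤ τ by omega) pG2.le]
      subst hG1 hG'
      omega
  · obtain ⟨rfl, rfl⟩ := eq_one_of_mul_mul_two_le_add hυ hτ c6
    have hef : e * f = 1 := by linarith
    obtain rfl : e = 1 := Int.eq_one_of_mul_eq_one_right he hef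
    obtain rfl : f = 1 := by omega
    subst hG1 hG2 hH1 hH2 hG
    obtain rfl | rfl : π = 1 ∨ π = 2 := by omega
    · omega
    · obtain rfl | rfl : σ = 1 ∨ σ = 2 := by omega
      · omega
      · omega
  · obtain ⟨rfl, rfl⟩ := eq_one_of_mul_mul_two_le_add hπ hσ c5
    have hef : e * f = 1 := by linarith
    obtain rfl : e = 1 := Int.eq_one_of_mul_eq_one_right he hef
    obtain rfl : f = 1 := by omega
    subst hG1 hG2 hH1 hH2 hG
    omega
  · obtain ⟨rfl, rfl⟩ := eq_one_of_mul_mul_two_le_add hπ hσ c5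
    have hef : e * f = 3 := by linarith
    have he3 : e ≤ 3 := Int.le_of_dvd (by norm_num) ⟨f, hef.symm⟩
    have hcase : e = 1 ∧ f = 3 ∨ e = 3 ∧ f = 1 := by
      clear * - he he3 hef
      interval_cases e <;> omega
    obtain ⟨rfl, rfl⟩ | ⟨rfl, rfl⟩ := hcase
    · subst hG1 hG2 hH1 hH2 hG
      omega
    · subst hG1 hG2 hH1 hH2 hG
      omega

/-- If `r` follows `i`, `s` follows `r`, the root `i` has globally maximal width, every root of
globally maximal width has only one farthest root, and neighbouring roots never have the same
single farthest root, then `s` has globally maximal width. -/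
theorem IsRootSet.exists_det2_next_next (hS : IsRootSet S) {G : ℤ}
    (hG : ∀ x ∈ S, ∀ y ∈ S, det2 x y ≤ G) (hGpos : 0 < G)
    (hsole : ∀ x ∈ S, ∀ y ∈ S, det2 x y = G → SoleFarthest S x y)
    (hno : ∀ r ∈ S, ∀ s ∈ S, ∀ w, Adj S r s → SoleFarthest S r w → SoleFarthest S s w → False)
    {i j r s : Fin 2 → ℤ} (hi : i ∈ S) (hj : j ∈ S) (hij : det2 i j = G) (hr : r ∈ S) (hs : s ∈ S)
    (hir : Adj S i r) (hrs : Adj S r s) : ∃ y ∈ S, det2 s y = G := by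
  obtain ⟨p, hp, hpi⟩ := hS.prev i hi
  obtain ⟨q, hq, hjq⟩ := hS.next j hj
  obtain ⟨o, ho, hoj⟩ := hS.prev j hj
  have hi' := hS.neg_mem i hi
  have hji : det2 j (-i) = G := by rw [det2_neg_right, ← det2_swap, hij]
  have sij := hsole i hi j hj hij
  have sji := hsole j hj (-i) hi' hji
  -- second farthest roots of the neighbours
  have two : ∀ a ∈ S, ∀ b ∈ S, SoleFarthest S a b → det2 a b = G → ∀ c ∈ S,
      (Adj S a c ∨ Adj S c a) →
      Farthest S c b ∧ det2 c b < G ∧ ∃ v ∈ S, det2 a v < G ∧ det2 c v = det2 c b := by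
    intro a ha b hb hab habG c hc hac
    obtain ⟨w, hw1, hw2⟩ := hS.exists_common_farthest hG ha hb habG hc hac
    obtain rfl := hw1.eq_of_sole hab
    -- Otherwise the neighbours `a` and `c` would share a sole farthest root. So `c` has a second
    -- farthest root and its width is below G.
    have hns : ¬ SoleFarthest S c w := by
      intro h
      rcases hac with hac | hac
      · exact hno a ha c hc w hac hab h
      · exact hno c hc a ha w hac h hab
    obtain ⟨v, hv, hvw, hcv⟩ := hw2.exists_ne hns
    refine ⟨hw2, lt_of_le_of_ne (hG c hc w hb) fun h => hns (hsole c hc w hb h), v, hv, ?_, hcv⟩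
    exact habG ▸ hab.2 v hv hvw
  obtain ⟨hrj, hrG, v1, hv1, hiv1, hrv1⟩ := two i hi j hj sij hij r hr (Or.inl hir)
  obtain ⟨hpj, hpG, v2, hv2, hiv2, hpv2⟩ := two i hi j hj sij hij p hp (Or.inr hpi)
  obtain ⟨hqi, hqG, v3, hv3, hjv3, hqv3⟩ := two j hj (-i) hi' sji hji q hq (Or.inl hjq)
  obtain ⟨hoi, hoG, v4, hv4, hjv4, hov4⟩ := two j hj (-i) hi' sji hji o ho (Or.inr hoj)
  have hrpos : 0 < det2 r j := by
    have := hrj.2 (-i) hi'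
    rw [det2_neg_right, ← det2_swap, hir.1] at this
    omega
  have hppos : 0 < det2 p j := by
    have := hpj.2 i hi
    rw [hpi.1] at this
    omega
  have hqpos : 0 < det2 q (-i) := by
    have := hqi.2 (-j) (hS.neg_mem j hj)
    rw [det2_neg_right, ← det2_swap, hjq.1] at this
    omega
  have hopos : 0 < det2 o (-i) := by
    have := hoi.2 j hj
    rw [hoj.1] at this
    omega
  -- determinants of the six roots around `i` and `j`
  have hip : det2 i p = -1 := by rw [det2_swap, hpi.1]
  have expand : ∀ x y, det2 x y = det2 i x * det2 r y - det2 r x * det2 i y := by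
    intro x y
    rw [← det2_mul_det2, hir.1, one_mul]
  have eqi : ∀ x, det2 q (-i) = det2 i q ∧ det2 o (-i) = det2 i o ∧ det2 x i = -det2 i x :=
    fun x => ⟨by rw [det2_neg_right, ← det2_swap], by rw [det2_neg_right, ← det2_swap],
      det2_swap _ _⟩
  rw [(eqi i).1] at hqpos hqG hqv3
  rw [(eqi i).2.1] at hopos hoG hov4
  -- Here det(p,j) = −det(r,p)·G − det(r,j), with det(p,j) and det(r,j) strictly between 0 and G.
  -- Together with the neighbour relations this means i = p + r; `hoq` similarly gives j = o + q.
  have hrp : det2 r p = -1 := by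
    have h := expand p j
    rw [hip, hij] at h
    have := eq_one_of_mul_pos_of_mul_lt (a := -det2 r p) hGpos (by linarith) (by linarith)
    omega
  have e1 : det2 i o * det2 r j - det2 r o * G = 1 := by rw [← hij, ← expand, hoj.1]
  have e2 : G * det2 r q - det2 r j * det2 i q = 1 := by rw [← hij, ← expand, hjq.1]
  have hGG : G = det2 r j + det2 p j := by rw [expand p j, hip, hrp, hij]; ring
  have hoq : det2 o q = 1 := by
    have h := det2_mul_det2 j q o (-i)
    rw [hjq.1, hji, (eqi i).1, (eqi i).2.1, det2_swap j o, hoj.1, det2_swap q o] at h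
    exact eq_one_of_mul_pos_of_mul_lt hGpos (by linarith) (by linarith)
  have hH : det2 i q + det2 i o = G := by
    have h := det2_mul_det2 j q o (-i)
    rw [hjq.1, hji, (eqi i).1, (eqi i).2.1, det2_swap j o, hoj.1, det2_swap q o, hoq] at h
    linarith
  have hrj2 : det2 r j = det2 r q + det2 r o := by
    have h := det2_mul_det2 o q r j
    rw [hoq, hoj.1, det2_swap q j, hjq.1, det2_swap o r, det2_swap q r] at h
    linarith
  -- coordinates of the second farthest roots
  have x3 : det2 i v3 = -((G - det2 j v3) * det2 i q) := by
    have h := det2_mul_det2 j q i v3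
    rw [hjq.1, hqv3, det2_swap j i, det2_swap q i, hij] at h
    linarith
  have y3 : det2 r v3 = 1 - (G - det2 j v3) * det2 r q := by
    have h := det2_mul_det2 j q r v3
    rw [hjq.1, hqv3, det2_swap j r, det2_swap q r] at h
    linarith
  have x4 : det2 i v4 = (G - det2 j v4) * det2 i o := by
    have h := det2_mul_det2 o j i v4
    rw [hoj.1, hov4, det2_swap j i, det2_swap o i, hij] at h
    linarith
  have y4 : det2 r v4 = 1 + (G - det2 j v4) * det2 r o := by
    have h := det2_mul_det2 o j r v4
    rw [hoj.1, hov4, det2_swap j r, det2_swap o r] at h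
    linarith
  have y2 : det2 r v2 = det2 i v2 - det2 p j := by
    have h := expand p v2
    rw [hpv2, hip, hrp] at h
    linarith
  have c1 := hG j hj v1 hv1
  have c2 := hG v2 hv2 j hj
  have c3 := hG i hi _ (hS.neg_mem v3 hv3)
  have c5 := hG _ (hS.neg_mem v3 hv3) v1 hv1
  have c6 := hG _ (hS.neg_mem v4 hv4) v2 hv2
  have sG : det2 i s ≤ G := hG i hi s hs
  have sjG := hG s hs j hj
  have sj := hrs.2 j hj
  have s3 := hrs.2 v3 hv3
  have sdet : ∀ y, det2 s y = det2 i s * det2 r y - det2 i y := by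
    intro y
    rw [expand s y, hrs.1, one_mul]
  have n2 := hS.det2_eq_one_or hr hv2 (Or.inl hir.1)
  have n3 := hS.det2_eq_one_or hr hv3 (Or.inl hir.1)
  have np := hS.det2_eq_one_or hp hv1 (Or.inr hip)
  have nq : det2 q v1 = 0 → det2 i v1 = det2 i q ∨ det2 i v1 = -det2 i q := by
    intro h
    rcases hS.collinear q hq v1 hv1 h with rfl | rfl
    · exact Or.inl rfl
    · exact Or.inr (det2_neg_right _ _)
  rw [expand p v1, hip, hrp] at np
  rw [expand q v1] at nq
  rw [expand, hrv1, hij] at c1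
  rw [expand, hij, y2] at c2
  rw [det2_neg_right, x3] at c3
  rw [det2_neg_left, expand, x3, y3, hrv1] at c5
  rw [det2_neg_left, expand, x4, y4, y2] at c6
  rw [sdet, hij] at sj sjG
  rw [sdet, x3, y3] at s3
  rw [y2] at n2
  rw [x3, y3] at n3
  rw [hrv1] at np nq
  -- The arguments a, b, e, f are det(r,q), det(p,o), det(p,q), det(r,o). The Greek ones measure by
  -- how much `v1`, `v2` miss width G from `i`, and `v3`, `v4` from `j`; moreover s = c·r − i.
  have hfin := next_next_arith (a := det2 r q) (b := det2 p j - (det2 i q - det2 r q))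
    (e := det2 i q - det2 r q) (f := det2 r o) (G := G) (G1 := det2 r j) (G2 := det2 p j)
    (H1 := det2 i q) (H2 := det2 i o) (σ := G - det2 i v1) (τ := G - det2 i v2)
    (π := G - det2 j v3) (υ := G - det2 j v4) (c := det2 i s)
    (by linarith) (by linarith) (by linarith) (by linarith) (by linarith)
    (by linear_combination e1)
    hrpos hppos hqpos hopos (by linarith) (by linarith) (by linarith) (by linarith)
    (by linear_combination c1)
    (by linear_combination c2 + det2 i v2 * hGG) (by linear_combination c3)
    (by linear_combination c5 + (G - det2 j v3) * e2)
    (by linear_combination c6 + (G - det2 j v4) * e1 + (G - det2 j v4) * det2 i o * hGG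
      - (G - det2 j v4) * (G - det2 i v2) * (hGG + hH + hrj2))
    (fun h => by
      have := n2 (by linarith)
      omega)
    (fun h => by
      have := n3 (by linarith)
      omega)
    (fun h => by
      have := np (by linarith)
      omega)
    (fun h => by
      have := nq (by linarith)
      omega)
    sG sjG sj s3
  rcases hfin with h | h | h
  -- The three outcomes of the arithmetic say that -i, `v1` or `j` has distance G from `s`.
  · refine ⟨-i, hi', ?_⟩
    rw [det2_neg_right, ← det2_swap, h]
  · refine ⟨v1, hv1, ?_⟩
    rw [sdet, hrv1]
    linarith
  · refine ⟨j, hj, ?_⟩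
    rw [sdet, hij, h]

end

/-! ### Cyclic order of the roots, and common sole farthest roots -/

section

variable {S : Set (Fin 2 → ℤ)}

/-- In a finite set of vectors in an open half plane, there is a first one and a last one with
respect to the angle. -/
theorem exists_extreme {F : Set (Fin 2 → ℤ)} (hF : F.Finite) (hne : F.Nonempty)
    {r : Fin 2 → ℤ} (hr : ∀ x ∈ F, 0 < det2 r x) :
    (∃ x ∈ F, ∀ y ∈ F, 0 ≤ det2 x y) ∧ ∃ x ∈ F, ∀ y ∈ F, 0 ≤ det2 y x := by
  obtain ⟨u, hu⟩ := hne
  -- On the half plane det(r,·) > 0 this quotient is a slope, monotone in the angle.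
  set f : (Fin 2 → ℤ) → ℚ := fun x => (det2 u x : ℚ) / det2 r x with hf
  have key : ∀ x ∈ F, ∀ y ∈ F, f x ≤ f y → 0 ≤ det2 x y := by
    intro x hx y hy h
    have hx' : (0 : ℚ) < det2 r x := by exact_mod_cast hr x hx
    have hy' : (0 : ℚ) < det2 r y := by exact_mod_cast hr y hy
    rw [hf, div_le_div_iff₀ hx' hy'] at h
    have h1 : det2 u x * det2 r y ≤ det2 u y * det2 r x := by exact_mod_cast h
    have h2 := det2_mul_det2 r u x y
    exact nonneg_of_mul_nonneg_right (by linarith) (hr u hu)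
  obtain ⟨x, hx, hxm⟩ := hF.exists_minimalFor f F ⟨u, hu⟩
  obtain ⟨z, hz, hzm⟩ := hF.exists_maximalFor f F ⟨u, hu⟩
  refine ⟨⟨x, hx, fun y hy => key x hx y hy ?_⟩, z, hz, fun y hy => key y hy z hz ?_⟩
  · exact (le_total (f x) (f y)).elim id fun h => hxm hy h
  · exact (le_total (f y) (f z)).elim id fun h => hzm hy h

/-- A nonempty symmetric set of roots which contains with each root the following one contains all
roots. -/
theorem IsRootSet.subset_of_next (hS : IsRootSet S) {X : Set (Fin 2 → ℤ)} (hX : X ⊆ S)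
    (hne : X.Nonempty) (hneg : ∀ x ∈ X, -x ∈ X)
    (hnext : ∀ x ∈ X, ∀ s ∈ S, Adj S x s → s ∈ X) : S ⊆ X := by
  intro k hk
  by_contra hkX
  have hkx : ∀ x ∈ X, det2 k x ≠ 0 := by
    intro x hx h
    rcases hS.collinear k hk x (hX hx) h with rfl | rfl
    · exact hkX hx
    · exact hkX (by simpa using hneg _ hx)
  have hFne : {x ∈ X | 0 < det2 k x}.Nonempty := by
    obtain ⟨x, hx⟩ := hne
    rcases lt_or_gt_of_ne (hkx x hx) with h | h
    · exact ⟨-x, hneg x hx, by rw [det2_neg_right]; omega⟩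
    · exact ⟨x, hx, h⟩
  -- Let `z` be the last element of `X` on the positive side of `k`. The successor `s` of -z cannot
  -- skip the line of `k`, so -s lies on the same side, after `z`.
  obtain ⟨z, ⟨hzX, hkz⟩, hz⟩ := (exists_extreme (hS.finite.subset fun x hx => hX hx.1) hFne
    fun x hx => hx.2).2
  obtain ⟨s, hs, hzs⟩ := hS.next (-z) (hX (hneg z hzX))
  have hsX := hnext _ (hneg z hzX) s hs hzs
  have h1 := hzs.2 k hk
  rw [det2_neg_left, ← det2_swap] at h1
  have h2 := nonneg_of_mul_nonneg_right h1 hkz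
  rw [det2_swap] at h2
  have h3 := hz (-s) ⟨hneg s hsX, by
    rw [det2_neg_right]
    have := hkx s hsX
    omega⟩
  have h4 := hzs.1
  rw [det2_neg_left, ← det2_swap] at h4
  rw [det2_neg_left] at h3
  omega

theorem IsRootSet.exists_adj_farthest (hS : IsRootSet S) :
    ∃ r ∈ S, ∃ s ∈ S, ∃ w, Adj S r s ∧ Farthest S r w ∧ Farthest S s w := by
  obtain ⟨G, -, hG, i, hi, j, hj, hij⟩ := hS.exists_max
  obtain ⟨s, hs, his⟩ := hS.next i hi
  obtain ⟨w, h1, h2⟩ := hS.exists_common_farthest hG hi hj hij hs (Or.inl his)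
  exact ⟨i, hi, s, hs, w, his, h1, h2⟩

/-- If some neighbouring roots have only one farthest root each, then some neighbouring roots have
the same single farthest root. -/
theorem IsRootSet.exists_adj_soleFarthest (hS : IsRootSet S) {k k' a b : Fin 2 → ℤ} (hk : k ∈ S)
    (hk' : k' ∈ S) (hkk : Adj S k k') (ha : SoleFarthest S k a) (hb : SoleFarthest S k' b) :
    ∃ r ∈ S, ∃ s ∈ S, ∃ w, Adj S r s ∧ SoleFarthest S r w ∧ SoleFarthest S s w := by
  by_contra! hno
  have hab : a ≠ b := by
    rintro rfl
    exact hno k hk k' hk' a hkk ha hb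
  obtain ⟨G, hGpos, hG, i, hi, j, hj, hij⟩ := hS.exists_max
  have hsole : ∀ x ∈ S, ∀ y ∈ S, det2 x y = G → SoleFarthest S x y := by
    intro x hx y hy hxy
    by_contra hns
    obtain ⟨z, hz, hzy, hxz⟩ :=
      Farthest.exists_ne (w := y) ⟨hy, fun v hv => hxy ▸ hG x hx v hv⟩ hns
    exact hab (hS.eq_of_two_farthest hG hGpos hx hz hy hzy (hxz.trans hxy) hxy hk hk' hkk ha hb)
  have hcommon : ∀ w, Farthest S k w → Farthest S k' w → False := fun w h1 h2 =>
    hab ((h1.eq_of_sole ha).symm.trans (h2.eq_of_sole hb))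
  have hstep : ∀ i ∈ S, (∃ y ∈ S, det2 i y = G) → ∀ r ∈ S, ∀ s ∈ S, Adj S i r → Adj S r s →
      ∃ y ∈ S, det2 s y = G := fun i hi ⟨j, hj, hij⟩ r hr s hs hir hrs =>
    hS.exists_det2_next_next hG hGpos hsole (fun r hr s hs w h1 h2 h3 => hno r hr s hs w h1 h2 h3)
      hi hj hij hr hs hir hrs
  -- The roots of width G and their successors form a set closed under successors, by `hstep`; hence
  -- these are all roots.
  have hsub := hS.subset_of_next
    (X := {x ∈ S | (∃ y ∈ S, det2 x y = G) ∨ ∃ i ∈ S, (∃ y ∈ S, det2 i y = G) ∧ Adj S i x})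
    (fun x hx => hx.1) ⟨i, hi, Or.inl ⟨j, hj, hij⟩⟩ ?_ ?_
  · rcases (hsub hk).2 with ⟨y, hy, hky⟩ | ⟨x, hx, hxG, hxk⟩
    · obtain ⟨w, h1, h2⟩ := hS.exists_common_farthest hG hk hy hky hk' (Or.inl hkk)
      exact hcommon w h1 h2
    · obtain ⟨y, hy, hky⟩ := hstep x hx hxG k hk k' hk' hxk hkk
      obtain ⟨w, h1, h2⟩ := hS.exists_common_farthest hG hk' hy hky hk (Or.inr hkk)
      exact hcommon w h2 h1
  · have hneg : ∀ x, (∃ y ∈ S, det2 x y = G) → ∃ y ∈ S, det2 (-x) y = G := by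
      rintro x ⟨y, hy, h⟩
      exact ⟨-y, hS.neg_mem y hy, by rw [det2_neg_left, det2_neg_right, neg_neg, h]⟩
    rintro x ⟨hx, h | ⟨i, hi, hiG, hix⟩⟩
    · exact ⟨hS.neg_mem x hx, Or.inl (hneg x h)⟩
    · refine ⟨hS.neg_mem x hx, Or.inr ⟨-i, hS.neg_mem i hi, hneg i hiG, ?_, fun y hy => ?_⟩⟩
      · rw [det2_neg_left, det2_neg_right, neg_neg, hix.1]
      · rw [det2_neg_left, det2_neg_left, neg_mul_neg]
        exact hix.2 y hy
  · rintro x ⟨hx, h | ⟨i, hi, hiG, hix⟩⟩ s hs hxs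
    · exact ⟨hs, Or.inr ⟨x, hx, h, hxs⟩⟩
    · exact ⟨hs, Or.inl (hstep i hi hiG x hx s hs hix hxs)⟩

end

/-! ### Linear forms with integral coordinates, and chambers -/

section

variable {V : Type*} [NormedAddCommGroup V] [NormedSpace ℝ V]

/-- The linear form with coordinates `x` with respect to `α`. -/
noncomputable def formOf (α : Module.Basis (Fin 2) ℝ (Module.Dual ℝ V)) (x : Fin 2 → ℤ) : Module.Dual ℝ V :=
  ∑ i, x i • α i

variable {α : Module.Basis (Fin 2) ℝ (Module.Dual ℝ V)}

theorem formOf_eq (x : Fin 2 → ℤ) : formOf α x = (x 0 : ℝ) • α 0 + (x 1 : ℝ) • α 1 := by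
  ext v
  simp [formOf, Fin.sum_univ_two]

theorem formOf_neg (x : Fin 2 → ℤ) : formOf α (-x) = -formOf α x := by
  simp [formOf]

theorem formOf_injective : Function.Injective (formOf α) := by
  intro x y h
  rw [formOf_eq, formOf_eq] at h
  have hc : ∀ i, ((x i : ℤ) : ℝ) = y i := by
    intro i
    have h1 := congrArg (fun φ => α.repr φ i) h
    fin_cases i <;> simpa using h1
  ext i
  exact_mod_cast hc i

/-- Cramer's rule. For det(r,s) = 1 it gives the coordinates of `x` in the basis (s, −r) as
(det(r,x), det(s,x)). -/
theorem det2_smul_formOf (r s x : Fin 2 → ℤ) : (det2 r s : ℝ) • formOf α x =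
    (det2 r x : ℝ) • formOf α s - (det2 s x : ℝ) • formOf α r := by
  simp only [formOf_eq, det2, Int.cast_sub, Int.cast_mul]
  module

theorem IsCrystallographic.finiteDimensional {R : Set (Module.Dual ℝ V)}
    (hR : IsCrystallographic 2 R) : FiniteDimensional ℝ V :=
  FiniteDimensional.of_finrank_pos (by rw [hR.finrank_eq]; norm_num)

theorem IsCrystallographic.neg_mem {R : Set (Module.Dual ℝ V)}
    (hR : IsCrystallographic 2 R) {β : Module.Dual ℝ V} (hβ : β ∈ R) : -β ∈ R := by
  have h : -β ∈ ({β, -β} : Set (Module.Dual ℝ V)) := by simp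
  rw [← hR.inter_span β hβ] at h
  exact h.1

/-- Finitely many nonzero forms have a common point of nonvanishing, found in the bidual and carried
back to `V`. -/
theorem IsCrystallographic.exists_isBasisAt {R : Set (Module.Dual ℝ V)}
    (hR : IsCrystallographic 2 R) : ∃ (K : Set V) (α : Module.Basis (Fin 2) ℝ (Module.Dual ℝ V)),
      IsChamber R K ∧ IsBasisAt R K α := by
  have := hR.finiteDimensional
  have := hR.finite.to_subtype
  obtain ⟨f, hf⟩ := Module.exists_dual_forall_apply_ne_zero (K := ℝ)
    (fun β : R => (β : Module.Dual ℝ V)) (fun β h => hR.zero_notMem (h ▸ β.2))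
  have hx : (Module.evalEquiv ℝ V).symm f ∈ hyperplaneCompl R := by
    rintro H ⟨β, hβ, rfl⟩ h
    apply hf ⟨β, hβ⟩
    simpa using h
  have hK : IsChamber R _ := ⟨_, hx, rfl⟩
  obtain ⟨α, hα⟩ := hR.simplicial _ hK
  exact ⟨_, α, hK, hα⟩

/-- An open cone on which all roots are nonzero is a chamber, if the forms defining it are
roots. -/
theorem IsBasisAt.isChamber [FiniteDimensional ℝ V] {R : Set (Module.Dual ℝ V)} {K : Set V}
    (hα : IsBasisAt R K α)
    (h : ∀ β ∈ R, ∀ v, (∀ i, 0 < α i v) → β v ≠ 0) : IsChamber R K := by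
  obtain ⟨hαR, rfl⟩ := hα
  have hcont : ∀ i, Continuous fun v => α i v := fun i =>
    LinearMap.continuous_of_finiteDimensional (α i)
  have hsub : {v | ∀ i, 0 < α i v} ⊆ hyperplaneCompl R := by
    rintro v hv H ⟨β, hβ, rfl⟩ hvH
    exact h β hβ v hv hvH
  let x : V := (Module.evalEquiv ℝ V).symm (α.coord 0 + α.coord 1)
  have hx : ∀ i, 0 < α i x := by
    intro i
    fin_cases i <;> simp [x]
  refine ⟨x, hsub hx, subset_antisymm ?_ ?_⟩
  · refine IsPreconnected.subset_connectedComponentIn ?_ hx hsub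
    refine Convex.isPreconnected ?_
    intro v hv w hw a b ha hb hab i
    rcases eq_or_lt_of_le ha with rfl | ha
    · obtain rfl : b = 1 := by linarith
      simpa using hw i
    · have h1 := mul_pos ha (hv i)
      have h2 := mul_nonneg hb (hw i).le
      simp only [map_add, map_smul, smul_eq_mul]
      linarith
  -- In the complement of the lines each point either lies in the cone or makes some basis form
  -- negative. These disjoint open sets confine the component to the cone.
  · have hopen : IsOpen {v | ∀ i, 0 < α i v} := by
      rw [Set.ofPred_forall]
      exact isOpen_iInter_of_finite fun i => isOpen_lt continuous_const (hcont i)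
    have hopen' : IsOpen {v | ∃ i, α i v < 0} := by
      rw [Set.ofPred_exists]
      exact isOpen_iUnion fun i => isOpen_lt (hcont i) continuous_const
    refine isPreconnected_connectedComponentIn.subset_left_of_subset_union hopen hopen' ?_ ?_
      ⟨x, mem_connectedComponentIn (hsub hx), hx⟩
    · rw [Set.disjoint_left]
      rintro v hv ⟨i, hi⟩
      exact absurd (hv i) (not_lt.2 hi.le)
    · intro v hv
      have hv' := connectedComponentIn_subset _ _ hv
      by_cases hpos : ∀ i, 0 < α i v
      · exact Or.inl hpos
      · push Not at hpos
        obtain ⟨i, hi⟩ := hpos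
        exact Or.inr ⟨i, lt_of_le_of_ne hi fun h0 => hv' _ ⟨α i, hαR i, rfl⟩ h0⟩

/-- Every pair of roots which are not separated by the line of another root is, up to signs, the
basis at a chamber. -/
theorem IsCrystallographic.exists_chamber {R : Set (Module.Dual ℝ V)}
    (hR : IsCrystallographic 2 R) {r s : Fin 2 → ℤ} (hr : r ∈ rootSystemAt R α)
    (hs : s ∈ rootSystemAt R α) (hrs : 0 < det2 r s)
    (hspan : ∀ β ∈ R, ∃ x, β = formOf α x)
    (h : ∀ x ∈ rootSystemAt R α, 0 ≤ det2 r x * det2 s x) :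
    ∃ (K : Set V) (α' : Module.Basis (Fin 2) ℝ (Module.Dual ℝ V)),
      IsChamber R K ∧ IsBasisAt R K α' ∧ α' 0 = formOf α s ∧ α' 1 = -formOf α r := by
  have := hR.finiteDimensional
  have hrs' : (0 : ℝ) < det2 r s := by exact_mod_cast hrs
  have hli : LinearIndependent ℝ ![formOf α s, -formOf α r] := by
    rw [LinearIndependent.pair_iff]
    intro a b hab
    rw [formOf_eq, formOf_eq] at hab
    have h0 := congrArg (fun φ => α.repr φ 0) hab
    have h1 := congrArg (fun φ => α.repr φ 1) hab
    simp at h0 h1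
    have hd : (det2 r s : ℝ) = r 0 * s 1 - r 1 * s 0 := by simp [det2]
    constructor
    · have : a * (det2 r s : ℝ) = 0 := by rw [hd]; linear_combination r 0 * h1 - r 1 * h0
      exact (mul_eq_zero.1 this).resolve_right hrs'.ne'
    · have : b * (det2 r s : ℝ) = 0 := by rw [hd]; linear_combination s 0 * h1 - s 1 * h0
      exact (mul_eq_zero.1 this).resolve_right hrs'.ne'
  let α' := basisOfLinearIndependentOfCardEqFinrank hli
    (by rw [Subspace.dual_finrank_eq, hR.finrank_eq, Fintype.card_fin])
  have h0 : α' 0 = formOf α s := by simp [α']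
  have h1 : α' 1 = -formOf α r := by simp [α']
  have hB : IsBasisAt R {v | ∀ i, 0 < α' i v} α' := by
    refine ⟨fun i => ?_, rfl⟩
    fin_cases i
    · change α' 0 ∈ R
      rw [h0]
      exact hs
    · change α' 1 ∈ R
      rw [h1]
      exact hR.neg_mem hr
  refine ⟨_, α', hB.isChamber ?_, hB, h0, h1⟩
  intro β hβ v hv hβv
  obtain ⟨x, rfl⟩ := hspan β hβ
  -- Cramer's rule at `v`: both terms have the same sign because `r` and `s` are not separated, so
  -- vanishing forces both coefficients to be zero.
  have e := congrArg (fun φ : Module.Dual ℝ V => φ v) (det2_smul_formOf (α := α) r s x)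
  have v0 := hv 0
  have v1 := hv 1
  rw [h0] at v0
  rw [h1] at v1
  simp only [LinearMap.smul_apply, LinearMap.sub_apply, LinearMap.neg_apply, smul_eq_mul, hβv,
    mul_zero] at e v1
  have hx := h x hβ
  have hzero : det2 r x = 0 ∧ det2 s x = 0 := by
    rcases lt_trichotomy (det2 r x) 0 with hc | hc | hc
    · have hc2 : det2 s x ≤ 0 := nonpos_of_mul_nonneg_right hx hc
      have hc' : (det2 r x : ℝ) < 0 := by exact_mod_cast hc
      have hc2' : (det2 s x : ℝ) ≤ 0 := by exact_mod_cast hc2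
      nlinarith [mul_pos_of_neg_of_neg hc' (neg_lt_zero.2 v0),
        mul_nonneg_of_nonpos_of_nonpos hc2' (neg_nonpos.2 v1.le)]
    · refine ⟨hc, ?_⟩
      rw [hc] at e
      have : (det2 s x : ℝ) = 0 := by
        have h2 : (det2 s x : ℝ) * (formOf α r) v = 0 := by push_cast at e; linarith
        exact (mul_eq_zero.1 h2).resolve_right (by linarith)
      exact_mod_cast this
    · have hc2 : 0 ≤ det2 s x := nonneg_of_mul_nonneg_right hx hc
      have hc' : 0 < (det2 r x : ℝ) := by exact_mod_cast hc
      have hc2' : 0 ≤ (det2 s x : ℝ) := by exact_mod_cast hc2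
      nlinarith [mul_pos hc' v0, mul_nonneg hc2' v1.le]
  have hform := det2_smul_formOf (α := α) r s x
  rw [hzero.1, hzero.2, Int.cast_zero, zero_smul, zero_smul, sub_zero, smul_eq_zero] at hform
  exact hR.zero_notMem (hform.resolve_left hrs'.ne' ▸ hβ)

end

/-! ### The root system at a chamber as a planar root set -/

section

variable {V : Type*} [NormedAddCommGroup V] [NormedSpace ℝ V]
  {α : Module.Basis (Fin 2) ℝ (Module.Dual ℝ V)} {R : Set (Module.Dual ℝ V)} {K : Set V}

theorem mem_rootSystemAt {x : Fin 2 → ℤ} : x ∈ rootSystemAt R α ↔ formOf α x ∈ R := Iff.rfl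

theorem formOf_add_mul (r s : Fin 2 → ℤ) (a b : ℤ) :
    formOf α (fun i => a * s i + b * r i) = (a : ℝ) • formOf α s + (b : ℝ) • formOf α r := by
  simp only [formOf_eq]
  push_cast
  module

theorem IsCrystallographic.exists_eq_formOf (hR : IsCrystallographic 2 R) (hK : IsChamber R K)
    (hα : IsBasisAt R K α) {β : Module.Dual ℝ V} (hβ : β ∈ R) :
    ∃ k : Fin 2 → ℤ, β = formOf α k := by
  obtain ⟨k, h | h⟩ := hR.crystallographic K hK α hα β hβ
  · exact ⟨fun i => k i, by simp [h, formOf]⟩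
  · exact ⟨-fun i => (k i : ℤ), by rw [formOf_neg, h]; simp [formOf]⟩

theorem formOf_single_zero : formOf α ![1, 0] = α 0 := by simp [formOf_eq]

theorem formOf_single_one : formOf α ![0, 1] = α 1 := by simp [formOf_eq]

theorem IsBasisAt.single_mem (hα : IsBasisAt R K α) :
    ![1, 0] ∈ rootSystemAt R α ∧ ![0, 1] ∈ rootSystemAt R α :=
  ⟨by rw [mem_rootSystemAt, formOf_single_zero]; exact hα.1 0,
    by rw [mem_rootSystemAt, formOf_single_one]; exact hα.1 1⟩

/-- By crystallographicity at the new chamber, `r` and `s` generate all roots over ℤ, in particular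
both unit vectors, so their determinant is invertible. -/
theorem IsCrystallographic.det2_eq_one (hR : IsCrystallographic 2 R) (hK : IsChamber R K)
    (hα : IsBasisAt R K α) {r s : Fin 2 → ℤ} (hr : r ∈ rootSystemAt R α)
    (hs : s ∈ rootSystemAt R α) (hrs : 0 < det2 r s)
    (h : ∀ x ∈ rootSystemAt R α, 0 ≤ det2 r x * det2 s x) : det2 r s = 1 := by
  obtain ⟨K', α', hK', hα', h0, h1⟩ := hR.exists_chamber hr hs hrs
    (fun β hβ => hR.exists_eq_formOf hK hα hβ) h
  have key : ∀ x ∈ rootSystemAt R α, ∃ a b : ℤ, ∀ i, x i = a * s i + b * r i := by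
    intro x hx
    obtain ⟨k, hk⟩ := hR.exists_eq_formOf hK' hα' (mem_rootSystemAt.1 hx)
    refine ⟨k 0, -k 1, fun i => ?_⟩
    refine congrFun (g := fun i => k 0 * s i + -k 1 * r i) (formOf_injective (α := α) ?_) i
    rw [formOf_add_mul, hk, formOf_eq, h0, h1]
    push_cast
    module
  obtain ⟨a, b, hab⟩ := key _ hα.single_mem.1
  obtain ⟨c, d, hcd⟩ := key _ hα.single_mem.2
  have e1 := hab 0
  have e2 := hab 1
  have e3 := hcd 0
  have e4 := hcd 1
  simp at e1 e2 e3 e4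
  refine Int.eq_one_of_dvd_one hrs.le ⟨b * c - a * d, ?_⟩
  simp only [det2]
  linear_combination e1 + (a * s 0 + b * r 0) * e4 - (c * s 0 + d * r 0) * e2

/-- The root systems at the chambers of a crystallographic arrangement with at least three
lines. -/
theorem IsCrystallographic.isRootSet (hR : IsCrystallographic 2 R) (hK : IsChamber R K)
    (hα : IsBasisAt R K α) (hR3 : 3 ≤ (hyperplanes R).ncard) : IsRootSet (rootSystemAt R α) := by
  have hfin : (rootSystemAt R α).Finite := hR.finite.preimage formOf_injective.injOn
  have hneg : ∀ x ∈ rootSystemAt R α, -x ∈ rootSystemAt R α := by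
    intro x hx
    rw [mem_rootSystemAt, formOf_neg]
    exact hR.neg_mem hx
  have hne : ∀ x ∈ rootSystemAt R α, x 0 ≠ 0 ∨ x 1 ≠ 0 := by
    intro x hx
    by_contra! h
    refine hR.zero_notMem ?_
    rwa [mem_rootSystemAt, formOf_eq, h.1, h.2, Int.cast_zero, zero_smul, zero_smul,
      add_zero] at hx
  have hcol : ∀ x ∈ rootSystemAt R α, ∀ y ∈ rootSystemAt R α, det2 x y = 0 →
      y = x ∨ y = -x := by
    intro x hx y hy h
    have hspan : ∃ c : ℝ, formOf α y = c • formOf α x := by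
      have hd : (x 0 : ℝ) * y 1 - x 1 * y 0 = 0 := by exact_mod_cast h
      rcases hne x hx with h0 | h0
      · have h0' : (x 0 : ℝ) ≠ 0 := by exact_mod_cast h0
        refine ⟨y 0 / x 0, ?_⟩
        rw [formOf_eq, formOf_eq, smul_add, smul_smul, smul_smul, div_mul_cancel₀ _ h0']
        congr 2
        field_simp
        linarith
      · have h0' : (x 1 : ℝ) ≠ 0 := by exact_mod_cast h0
        refine ⟨y 1 / x 1, ?_⟩
        rw [formOf_eq, formOf_eq, smul_add, smul_smul, smul_smul, div_mul_cancel₀ _ h0']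
        congr 2
        field_simp
        linarith
    obtain ⟨c, hc⟩ := hspan
    have hmem : formOf α y ∈ R ∩ (Submodule.span ℝ {formOf α x} : Set (Module.Dual ℝ V)) :=
      ⟨hy, hc ▸ Submodule.smul_mem _ _ (Submodule.mem_span_singleton_self _)⟩
    rw [hR.inter_span _ (mem_rootSystemAt.1 hx)] at hmem
    rcases hmem with h | h
    · exact Or.inl (formOf_injective h)
    · exact Or.inr (formOf_injective (h.trans (formOf_neg x).symm))
  have hhalf : ∀ r ∈ rootSystemAt R α, {x ∈ rootSystemAt R α | 0 < det2 r x}.Nonempty := by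
    intro r hr
    have key : ∀ x ∈ rootSystemAt R α, det2 r x ≠ 0 →
        {x ∈ rootSystemAt R α | 0 < det2 r x}.Nonempty := by
      intro x hx h
      rcases lt_or_gt_of_ne h with h | h
      · exact ⟨-x, hneg x hx, by rw [det2_neg_right]; omega⟩
      · exact ⟨x, hx, h⟩
    rcases hne r hr with h | h
    · exact key _ hα.single_mem.2 (by simpa [det2] using h)
    · exact key _ hα.single_mem.1 (by simpa [det2] using h)
  refine ⟨hfin, hneg, hcol, ⟨_, hα.single_mem.1⟩, fun r hr => ?_, fun r hr => ?_,
    fun r hr s hs => ?_⟩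
  -- The successor of `r` is the first root by angle in the open half plane to its positive side.
  · obtain ⟨s, ⟨hs, hrs⟩, hmin⟩ := (exists_extreme (hfin.subset fun x hx => hx.1) (hhalf r hr)
      fun x hx => hx.2).1
    have h : ∀ x ∈ rootSystemAt R α, 0 ≤ det2 r x * det2 s x := by
      intro x hx
      rcases lt_trichotomy (det2 r x) 0 with h | h | h
      · have := hmin (-x) ⟨hneg x hx, by rw [det2_neg_right]; omega⟩
        rw [det2_neg_right] at this
        exact mul_nonneg_of_nonpos_of_nonpos h.le (by omega)
      · rw [h, zero_mul]
      · exact mul_nonneg h.le (hmin x ⟨hx, h⟩)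
    exact ⟨s, hs, hR.det2_eq_one hK hα hr hs hrs h, h⟩
  · obtain ⟨s, ⟨hs, hrs⟩, hmax⟩ := (exists_extreme (hfin.subset fun x hx => hx.1) (hhalf r hr)
      fun x hx => hx.2).2
    have h : ∀ x ∈ rootSystemAt R α, 0 ≤ det2 (-s) x * det2 r x := by
      intro x hx
      rw [det2_neg_left, ← det2_swap]
      rcases lt_trichotomy (det2 r x) 0 with h | h | h
      · have := hmax (-x) ⟨hneg x hx, by rw [det2_neg_right]; omega⟩
        rw [det2_neg_left] at this
        exact mul_nonneg_of_nonpos_of_nonpos (by omega) h.le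
      · rw [h, mul_zero]
      · exact mul_nonneg (hmax x ⟨hx, h⟩) h.le
    exact ⟨-s, hneg s hs, hR.det2_eq_one hK hα (hneg s hs) hr
      (by rw [det2_neg_left, ← det2_swap]; exact hrs) h, h⟩
  · by_contra! hc
    have hsub : hyperplanes R ⊆ {LinearMap.ker (formOf α r), LinearMap.ker (formOf α s)} := by
      rintro H ⟨β, hβ, rfl⟩
      obtain ⟨x, rfl⟩ := hR.exists_eq_formOf hK hα hβ
      have hker : ∀ y ∈ rootSystemAt R α, det2 y x = 0 →
          LinearMap.ker (formOf α x) = LinearMap.ker (formOf α y) := by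
        intro y hy h
        rcases hcol y hy x hβ h with rfl | rfl
        · rfl
        · ext v
          simp [formOf_neg]
      by_cases h : det2 r x = 0
      · exact Or.inl (hker r hr h)
      · exact Or.inr (hker s hs (hc x hβ h))
    have h1 := Set.ncard_le_ncard hsub
    have h2 := Set.ncard_insert_le (LinearMap.ker (formOf α r)) {LinearMap.ker (formOf α s)}
    rw [Set.ncard_singleton] at h2
    omega

/-- Neighbouring roots give a chamber, and the root system at this chamber consists of the
determinants with these two roots. -/
theorem IsCrystallographic.exists_chamber_rootSystemAt (hR : IsCrystallographic 2 R)
    (hK : IsChamber R K) (hα : IsBasisAt R K α) {r s : Fin 2 → ℤ} (hr : r ∈ rootSystemAt R α)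
    (hs : s ∈ rootSystemAt R α) (hrs : Adj (rootSystemAt R α) r s) :
    ∃ (K' : Set V) (α' : Module.Basis (Fin 2) ℝ (Module.Dual ℝ V)),
      IsChamber R K' ∧ IsBasisAt R K' α' ∧
      ∀ y, y ∈ rootSystemAt R α' ↔ ∃ x ∈ rootSystemAt R α, y = ![det2 r x, det2 s x] := by
  obtain ⟨K', α', hK', hα', h0, h1⟩ := hR.exists_chamber hr hs (by rw [hrs.1]; norm_num)
    (fun β hβ => hR.exists_eq_formOf hK hα hβ) hrs.2
  have hform : ∀ y : Fin 2 → ℤ, formOf α' y = formOf α (fun i => y 0 * s i + -y 1 * r i) := by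
    intro y
    rw [formOf_add_mul, formOf_eq, h0, h1]
    push_cast
    module
  have hd := hrs.1
  simp only [det2] at hd
  refine ⟨K', α', hK', hα', fun y => ⟨fun hy => ?_, ?_⟩⟩
  · rw [mem_rootSystemAt, hform] at hy
    refine ⟨_, hy, ?_⟩
    ext i
    fin_cases i
    · simp only [det2, Fin.zero_eta, Matrix.cons_val_zero]
      linear_combination -y 0 * hd
    · simp only [det2, Fin.mk_one, Matrix.cons_val_one]
      simp
      linear_combination -y 1 * hd
  · rintro ⟨x, hx, rfl⟩
    have hx' : (fun i => det2 r x * s i + -det2 s x * r i) = x := by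
      ext i
      fin_cases i
      · simp [det2]
        linear_combination x 0 * hd
      · simp [det2]
        linear_combination x 1 * hd
    rw [mem_rootSystemAt, hform]
    exact hx'.symm ▸ hx

end

/-! ### Sequences attached to triangulated polygons -/

theorem etaProd_self (c : List ℤ) (i : ℕ) : etaProd c i i = 1 := by simp [etaProd]

theorem etaProd_mul (c : List ℤ) {i j k : ℕ} (hij : i ≤ j) (hjk : j ≤ k) :
    etaProd c i j * etaProd c j k = etaProd c i k := by
  rw [etaProd, etaProd, etaProd, ← List.prod_append, ← List.map_append,
    show k - i = (j - i) + (k - j) by omega, List.take_add, List.drop_drop,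
    show i + (j - i) = j by omega]

theorem etaProd_succ {l : List ℤ} {i : ℕ} (hi : i < l.length) :
    etaProd l i (i + 1) = eta l[i] := by
  rw [etaProd, List.drop_eq_getElem_cons hi, Nat.add_sub_cancel_left, List.take_succ_cons,
    List.take_zero, List.map_singleton, List.prod_singleton]

theorem etaProd_cons_succ (x : ℤ) (l : List ℤ) (i j : ℕ) :
    etaProd (x :: l) (i + 1) (j + 1) = etaProd l i j := by
  simp [etaProd]

theorem etaProd_cons_zero (x : ℤ) (l : List ℤ) (j : ℕ) :
    etaProd (x :: l) 0 (j + 1) = eta x * etaProd l 0 j := by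
  simp [etaProd]

theorem etaProd_zero_length (c : List ℤ) : etaProd c 0 c.length = (c.map eta).prod := by
  simp [etaProd]

theorem det_eta (a : ℤ) : (eta a).det = 1 := by simp [eta, Matrix.det_fin_two]

theorem det_etaProd (c : List ℤ) (i j : ℕ) : (etaProd c i j).det = 1 := by
  rw [etaProd]
  induction (c.drop i).take (j - i) with
  | nil => simp
  | cons a l ih => rw [List.map_cons, List.prod_cons, Matrix.det_mul, ih, det_eta, one_mul]

/-- Both entries depend only on the interior factors at positions i+1, …, j−1; this makes φ
compatible with reversal. -/
theorem etaProd_one_zero_eq {c : List ℤ} {i j : ℕ} (hij : i < j) (hj : j < c.length) :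
    etaProd c i j 1 0 = -etaProd c (i + 1) (j + 1) 0 1 := by
  rw [← etaProd_mul c (Nat.le_succ i) hij, etaProd_succ (hij.trans hj),
    ← etaProd_mul c (show i + 1 ≤ j from hij) (Nat.le_succ j), etaProd_succ hj]
  simp [eta, Matrix.mul_apply, Fin.sum_univ_two]

/-- Transposing `eta a` amounts to conjugating it by diag(1, −1), and transposition reverses
products. -/
theorem prod_map_eta_reverse (l : List ℤ) : (l.reverse.map eta).prod =
    !![(l.map eta).prod 0 0, -(l.map eta).prod 1 0;
      -(l.map eta).prod 0 1, (l.map eta).prod 1 1] := by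
  induction l with
  | nil =>
    ext i j
    fin_cases i <;> fin_cases j <;> simp
  | cons a l ih =>
    rw [List.reverse_cons, List.map_append, List.prod_append, ih, List.map_singleton,
      List.prod_singleton, List.map_cons, List.prod_cons]
    ext i j
    fin_cases i <;> fin_cases j <;> simp [Matrix.mul_apply, Fin.sum_univ_two, eta] <;> ring

theorem etaProd_reverse {c : List ℤ} {i j : ℕ} (hij : i < j) (hj : j < c.length) :
    etaProd c.reverse i j 1 0 = etaProd c (c.length - 1 - j) (c.length - 1 - i) 1 0 := by
  have h : (c.reverse.drop i).take (j - i) =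
      ((c.drop (c.length - j)).take (j - i)).reverse := by
    rw [List.drop_reverse, List.take_reverse, List.drop_take, List.length_take,
      min_eq_left (by omega), show c.length - i - (j - i) = c.length - j by omega,
      show c.length - i - (c.length - j) = j - i by omega]
  rw [etaProd_one_zero_eq (i := c.length - 1 - j) (by omega) (by omega), etaProd, h,
    prod_map_eta_reverse, show c.length - 1 - j + 1 = c.length - j by omega,
    show c.length - 1 - i + 1 = c.length - i by omega, etaProd,
    show c.length - i - (c.length - j) = j - i by omega]
  simp

theorem IsEtaSeq.prod_eq {c : List ℤ} (hc : IsEtaSeq c) : (c.map eta).prod = -1 := by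
  induction hc with
  | base =>
    ext i j
    fin_cases i <;> fin_cases j <;> simp [eta]
  | rotate a l _ ih =>
    rw [List.map_cons, List.prod_cons] at ih
    rw [List.map_append, List.prod_append, List.map_singleton, List.prod_singleton]
    have h : eta a * -(l.map eta).prod = 1 := by rw [mul_neg, ih, neg_neg]
    rw [← neg_neg (_ * _), ← neg_mul, mul_eq_one_comm.1 h]
  | reflect l _ ih =>
    rw [prod_map_eta_reverse, ih]
    ext i j
    fin_cases i <;> fin_cases j <;> simp
  | ear a b l _ ih =>
    rw [← ih]
    simp only [List.map_cons, List.prod_cons, ← mul_assoc]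
    congr 1
    ext i j
    fin_cases i <;> fin_cases j <;> simp [eta, Matrix.mul_apply, Fin.sum_univ_two] 
    ring

theorem etaProd_append_singleton {l : List ℤ} (a : ℤ) {i j : ℕ} (hj : j ≤ l.length) :
    etaProd (l ++ [a]) i j = etaProd l i j := by
  rcases le_total j i with h | h
  · simp [etaProd, Nat.sub_eq_zero_of_le h]
  · rw [etaProd, etaProd, List.drop_append_of_le_length (h.trans hj), List.take_append_of_le_length]
    simp
    omega

/-- The frieze belonging to an `η`-sequence has positive entries. -/
theorem IsEtaSeq.etaProd_pos {c : List ℤ} (hc : IsEtaSeq c) {i j : ℕ} (hij : i < j)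
    (hj : j < c.length) : 0 < etaProd c i j 1 0 := by
  induction hc generalizing i j with
  | base =>
    obtain ⟨rfl, rfl⟩ : i = 0 ∧ j = 1 := by
      simp at hj
      omega
    simp [etaProd, eta]
  | rotate a l h ih =>
    rw [List.length_append, List.length_singleton] at hj
    rw [etaProd_append_singleton a (by omega), ← etaProd_cons_succ a]
    rcases eq_or_lt_of_le (show j ≤ l.length by omega) with rfl | hjl
    · have h1 := ih (Nat.succ_pos i) (by simpa using hij)
      have h2 := etaProd_mul (a :: l) (Nat.zero_le (i + 1)) (show i + 1 ≤ l.length + 1 by omega)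
      have h3 := etaProd_zero_length (a :: l)
      rw [List.length_cons] at h3
      rw [h3, h.prod_eq] at h2
      have h4 := det_etaProd (a :: l) 0 (i + 1)
      rw [Matrix.det_fin_two] at h4
      have h5 := congrFun (congrFun h2 0) 0
      have h6 := congrFun (congrFun h2 1) 0
      simp only [Matrix.mul_apply, Fin.sum_univ_two, Matrix.neg_apply, Matrix.one_apply_eq,
        Matrix.one_apply_ne (show (1 : Fin 2) ≠ 0 by decide), neg_zero] at h5 h6
      convert h1 using 1
      simp only [Nat.succ_eq_add_one]
      linear_combination -(etaProd (a :: l) (i + 1) (l.length + 1) 1 0) * h4 +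
        etaProd (a :: l) 0 (i + 1) 0 0 * h6 - etaProd (a :: l) 0 (i + 1) 1 0 * h5
    · exact ih (by omega) (by simpa using hjl)
  | reflect l _ ih =>
    rw [List.length_reverse] at hj
    rw [etaProd_reverse hij hj]
    exact ih (by omega) (by omega)
  | ear a b l _ ih =>
    have hone : ∀ (x : ℤ) (M : Matrix (Fin 2) (Fin 2) ℤ), (eta x * M) 1 0 = M 0 0 := by
      intro x M
      simp [eta, Matrix.mul_apply, Fin.sum_univ_two]
    have hzero : ∀ (x : ℤ) (M : Matrix (Fin 2) (Fin 2) ℤ),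
        (eta x * M) 0 0 = x * M 0 0 - M 1 0 := by
      intro x M
      simp [eta, Matrix.mul_apply, Fin.sum_univ_two]
      ring
    -- These are the old entries starting at the two neighbours of the ear. The entry starting at
    -- the ear is their sum.
    have key : ∀ k, k < l.length → 0 < b * etaProd l 0 k 0 0 - etaProd l 0 k 1 0 ∧
        0 < etaProd l 0 k 0 0 := by
      intro k hk
      have h1 := ih (i := 0) (j := k + 2) (by omega) (by simpa using hk)
      have h2 := ih (i := 1) (j := k + 2) (by omega) (by simpa using hk)
      rw [etaProd_cons_zero, etaProd_cons_zero, hone, hzero] at h1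
      rw [etaProd_cons_succ a _ 0 (k + 1), etaProd_cons_zero, hone] at h2
      exact ⟨h1, h2⟩
    have hlen : j < l.length + 3 := hj
    obtain _ | _ | _ | j := j
    · omega
    · obtain rfl : i = 0 := by omega
      rw [etaProd_cons_zero, etaProd_self, hone]
      norm_num
    · obtain rfl | rfl : i = 0 ∨ i = 1 := by omega
      · rw [etaProd_cons_zero, etaProd_cons_zero, etaProd_self, hone, hzero]
        norm_num
      · rw [etaProd_cons_succ _ _ 0 1, etaProd_cons_zero, etaProd_self, hone]
        norm_num
    · obtain ⟨k1, k2⟩ := key j (by omega)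
      obtain _ | _ | _ | i := i
      · rw [etaProd_cons_zero, etaProd_cons_zero, etaProd_cons_zero, hone, hzero, hzero, hone]
        linarith
      · rw [etaProd_cons_succ _ _ 0 (j + 2), etaProd_cons_zero, etaProd_cons_zero, hone, hzero]
        linarith
      · rw [etaProd_cons_succ _ _ 1 (j + 2), etaProd_cons_succ _ _ 0 (j + 1), etaProd_cons_zero,
          hone]
        exact k2
      · have h := ih (i := i + 2) (j := j + 2) (by omega) (by simp; omega)
        rw [etaProd_cons_succ, etaProd_cons_succ] at h
        rwa [etaProd_cons_succ, etaProd_cons_succ, etaProd_cons_succ]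

/-! ### Realization of the frieze by vectors in ℤ² -/

/-- The vertices of the polygon with quiddity cycle `c`: the first columns of the matrices
`η(c_0) ⋯ η(c_{j-1})`. -/
def vertex (c : List ℤ) (j : ℕ) : Fin 2 → ℤ := fun k => etaProd c 0 j k 0

theorem det2_vertex (c : List ℤ) {i j : ℕ} (hij : i ≤ j) :
    det2 (vertex c i) (vertex c j) = etaProd c i j 1 0 := by
  have h := det_etaProd c 0 i
  rw [Matrix.det_fin_two] at h
  simp only [det2, vertex]
  rw [← etaProd_mul c (Nat.zero_le i) hij]
  simp only [Matrix.mul_apply, Fin.sum_univ_two]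
  linear_combination etaProd c i j 1 0 * h

theorem IsEtaSeq.vertex_length {c : List ℤ} (hc : IsEtaSeq c) :
    vertex c c.length = -vertex c 0 := by
  ext k
  rw [vertex, etaProd_zero_length, hc.prod_eq, Pi.neg_apply, vertex, etaProd_self,
    Matrix.neg_apply]

theorem IsEtaSeq.det2_vertex_nonneg {c : List ℤ} (hc : IsEtaSeq c) {i j : ℕ} (hij : i ≤ j)
    (hj : j ≤ c.length) : 0 ≤ det2 (vertex c i) (vertex c j) := by
  have key : ∀ {i j : ℕ}, i ≤ j → j < c.length → 0 ≤ det2 (vertex c i) (vertex c j) := by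
    intro i j hij hj
    rcases eq_or_lt_of_le hij with rfl | hij
    · rw [det2_self]
    · rw [det2_vertex c hij.le]
      exact (hc.etaProd_pos hij hj).le
  rcases eq_or_lt_of_le hj with rfl | hj
  · rw [hc.vertex_length, det2_neg_right, ← det2_swap]
    rcases eq_or_lt_of_le hij with rfl | hij
    · rw [hc.vertex_length, det2_neg_right, det2_self, neg_zero]
    · exact key (Nat.zero_le i) hij
  · exact key hij hj

theorem det2_vertex_succ {c : List ℤ} {i : ℕ} (hi : i < c.length) :
    det2 (vertex c i) (vertex c (i + 1)) = 1 := by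
  rw [det2_vertex c (Nat.le_succ i), etaProd_succ hi]
  simp [eta]

/-- Absolute values absorb the order of the indices, and also the sign change of the vertices after
one turn around the polygon. -/
theorem IsEtaSeq.phi_eq_abs {c : List ℤ} (hc : IsEtaSeq c) {i j : ℕ} (hi : i < c.length)
    (hj : j < c.length) : phi c i j = |det2 (vertex c i) (vertex c j)| := by
  rw [phi]
  split_ifs with h1 h2
  · rw [h1, det2_self, abs_zero]
  · rw [abs_of_nonneg (hc.det2_vertex_nonneg h2.le hj.le), det2_vertex c h2.le]
  · rw [det2_swap, abs_neg, abs_of_nonneg (hc.det2_vertex_nonneg (by omega) hi.le),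
      det2_vertex c (by omega)]

theorem IsEtaSeq.phi_succ_mod_eq_abs {c : List ℤ} (hc : IsEtaSeq c) {i j : ℕ} (hi : i < c.length)
    (hj : j < c.length) :
    phi c ((i + 1) % c.length) j = |det2 (vertex c (i + 1)) (vertex c j)| := by
  rcases eq_or_lt_of_le (Nat.succ_le_of_lt hi) with h | h
  · rw [Nat.succ_eq_add_one] at h
    rw [h, Nat.mod_self, hc.vertex_length, det2_neg_left, abs_neg, hc.phi_eq_abs (by omega) hj]
  · rw [Nat.mod_eq_of_lt h, hc.phi_eq_abs h hj]

theorem IsEtaSeq.vertex_mul_vertex_nonneg {c : List ℤ} (hc : IsEtaSeq c) {i j : ℕ}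
    (hi : i < c.length) (hj : j < c.length) :
    0 ≤ det2 (vertex c i) (vertex c j) * det2 (vertex c (i + 1)) (vertex c j) := by
  rcases le_or_gt j i with h | h
  · rw [det2_swap, det2_swap (vertex c (i + 1)), neg_mul_neg]
    exact mul_nonneg (hc.det2_vertex_nonneg h hi.le) (hc.det2_vertex_nonneg (by omega) hi)
  · exact mul_nonneg (hc.det2_vertex_nonneg h.le hj.le) (hc.det2_vertex_nonneg h hj.le)

/-! ### Edge coordinates and density -/

/-- The coordinates of a vector with respect to an edge of the polygon. -/
def edgeCoord (c : List ℤ) (i : ℕ) (x : Fin 2 → ℤ) : Fin 2 → ℤ :=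
  ![det2 (vertex c i) x, det2 (vertex c (i + 1)) x]

theorem det2_edgeCoord {c : List ℤ} {i : ℕ} (hi : i < c.length) (x y : Fin 2 → ℤ) :
    det2 (edgeCoord c i x) (edgeCoord c i y) = det2 x y := by
  have h := det2_mul_det2 (vertex c i) (vertex c (i + 1)) x y
  rw [det2_vertex_succ hi, one_mul] at h
  exact h.symm

theorem edgeCoord_neg (c : List ℤ) (i : ℕ) (x : Fin 2 → ℤ) :
    edgeCoord c i (-x) = -edgeCoord c i x := by
  ext k
  fin_cases k <;> simp [edgeCoord, det2_neg_right]

theorem abs_pair_eq {a b : ℤ} (h : 0 ≤ a * b) :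
    ![|a|, |b|] = ![a, b] ∨ ![|a|, |b|] = -![a, b] := by
  rcases mul_nonneg_iff.1 h with h | h
  · rw [abs_of_nonneg h.1, abs_of_nonneg h.2]
    exact Or.inl rfl
  · rw [abs_of_nonpos h.1, abs_of_nonpos h.2]
    right
    ext k
    fin_cases k <;> simp

theorem IsEtaSeq.mem_edgeRoots_or {c : List ℤ} (hc : IsEtaSeq c) {i : ℕ} (hi : i < c.length)
    (x : Fin 2 → ℤ) : (x ∈ edgeRoots c i ∨ -x ∈ edgeRoots c i) ↔
      ∃ j < c.length, x = edgeCoord c i (vertex c j) ∨ x = -edgeCoord c i (vertex c j) := by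
  have key : ∀ j < c.length,
      ![phi c i j, phi c ((i + 1) % c.length) j] = edgeCoord c i (vertex c j) ∨
      ![phi c i j, phi c ((i + 1) % c.length) j] = -edgeCoord c i (vertex c j) := by
    intro j hj
    rw [hc.phi_eq_abs hi hj, hc.phi_succ_mod_eq_abs hi hj]
    exact abs_pair_eq (hc.vertex_mul_vertex_nonneg hi hj)
  constructor
  · rintro (⟨j, hj, h⟩ | ⟨j, hj, h⟩) <;> refine ⟨j, hj, ?_⟩ <;> rcases key j hj with h' | h' <;>
      rw [h'] at h
    · exact Or.inl h
    · exact Or.inr h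
    · exact Or.inr (neg_eq_iff_eq_neg.1 h)
    · exact Or.inl (neg_injective h)
  · rintro ⟨j, hj, h | h⟩ <;> rcases key j hj with h' | h'
    · exact Or.inl ⟨j, hj, h.trans h'.symm⟩
    · exact Or.inr ⟨j, hj, by rw [h', h]⟩
    · exact Or.inr ⟨j, hj, by rw [h', h, neg_neg]⟩
    · exact Or.inl ⟨j, hj, h.trans h'.symm⟩

/-- If `φ` has a unique maximum at the position of the vertex `u`, then `u` has a single farthest
root. -/
theorem exists_soleFarthest_of_card_le_one {c : List ℤ} {S : Set (Fin 2 → ℤ)} {i p : ℕ}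
    {u : Fin 2 → ℤ} (hi : i < c.length)
    (hS : ∀ x, x ∈ S ↔
      ∃ j < c.length, x = edgeCoord c i (vertex c j) ∨ x = -edgeCoord c i (vertex c j))
    (hphi : ∀ j < c.length, phi c p j = |det2 u (vertex c j)|)
    (hpos : ∃ j < c.length, 0 < phi c p j) (hcard : (maxSet c p).card ≤ 1) :
    ∃ w, SoleFarthest S (edgeCoord c i u) w := by
  obtain ⟨l, hl, hlpos⟩ := hpos
  obtain ⟨m, hm, hmax⟩ := (Finset.range c.length).exists_max_image (phi c p)
    ⟨l, Finset.mem_range.2 hl⟩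
  have hmlt : m < c.length := Finset.mem_range.1 hm
  have hmS : m ∈ maxSet c p := Finset.mem_filter.2 ⟨hm, hmax⟩
  have hmpos : 0 < phi c p m := hlpos.trans_le (hmax l (Finset.mem_range.2 hl))
  have hlt : ∀ j < c.length, j ≠ m → phi c p j < phi c p m := by
    intro j hj hjm
    refine lt_of_le_of_ne (hmax j (Finset.mem_range.2 hj)) fun h => hjm ?_
    refine Finset.card_le_one.1 hcard j (Finset.mem_filter.2 ⟨Finset.mem_range.2 hj, ?_⟩) m hmS
    rw [h]
    exact hmax
  -- Each position contributes a vector and its negative. The sign of `z` is chosen so that its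
  -- determinant with `u` is the positive maximum, which excludes -z.
  have main : ∀ z : Fin 2 → ℤ, (z = vertex c m ∨ z = -vertex c m) → det2 u z = phi c p m →
      SoleFarthest S (edgeCoord c i u) (edgeCoord c i z) := by
    intro z hz hzm
    refine ⟨(hS _).2 ⟨m, hmlt, ?_⟩, fun x hx hxz => ?_⟩
    · rcases hz with rfl | rfl
      · exact Or.inl rfl
      · exact Or.inr (edgeCoord_neg _ _ _)
    · rw [det2_edgeCoord hi, hzm]
      obtain ⟨j, hj, hxj⟩ := (hS x).1 hx
      obtain ⟨y, hy, rfl⟩ : ∃ y, (y = vertex c j ∨ y = -vertex c j) ∧ x = edgeCoord c i y := by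
        rcases hxj with h | h
        · exact ⟨_, Or.inl rfl, h⟩
        · exact ⟨_, Or.inr rfl, h.trans (edgeCoord_neg _ _ _).symm⟩
      rw [det2_edgeCoord hi]
      by_cases hjm : j = m
      · subst hjm
        have hyz : y = -z := by
          rcases hy with rfl | rfl <;> rcases hz with rfl | rfl
          · exact absurd rfl hxz
          · rw [neg_neg]
          · rfl
          · exact absurd rfl hxz
        rw [hyz, det2_neg_right]
        omega
      · refine lt_of_le_of_lt ?_ (hlt j hj hjm)
        rw [hphi j hj]
        rcases hy with rfl | rfl
        · exact le_abs_self _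
        · rw [det2_neg_right]
          exact neg_le_abs _
  rcases abs_choice (det2 u (vertex c m)) with h | h
  · exact ⟨_, main _ (Or.inl rfl) (by rw [hphi m hmlt, h])⟩
  · exact ⟨_, main _ (Or.inr rfl) (by rw [hphi m hmlt, h, det2_neg_right])⟩

theorem IsEtaSeq.exists_adj_soleFarthest {c : List ℤ} (hc : IsEtaSeq c) {i : ℕ}
    (hi : i < c.length) {S : Set (Fin 2 → ℤ)}
    (hS : S = {x | x ∈ edgeRoots c i ∨ -x ∈ edgeRoots c i}) (hnd : ¬ IsDense c) :
    ∃ r ∈ S, ∃ s ∈ S, ∃ a b, Adj S r s ∧ SoleFarthest S r a ∧ SoleFarthest S s b := by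
  have hS' : ∀ x, x ∈ S ↔
      ∃ j < c.length, x = edgeCoord c i (vertex c j) ∨ x = -edgeCoord c i (vertex c j) := by
    intro x
    rw [hS]
    exact hc.mem_edgeRoots_or hi x
  rw [IsDense] at hnd
  push Not at hnd
  obtain ⟨k, hk, h1, h2⟩ := hnd
  have hsucc := det2_vertex_succ hk
  have hmod : (k + 1) % c.length < c.length := Nat.mod_lt _ (by omega)
  obtain ⟨a, ha⟩ := exists_soleFarthest_of_card_le_one (u := vertex c k) hi hS'
    (fun j hj => hc.phi_eq_abs hk hj) ⟨(k + 1) % c.length, hmod, by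
      rcases eq_or_lt_of_le (Nat.succ_le_of_lt hk) with h | h
      · rw [Nat.succ_eq_add_one] at h
        rw [h, hc.vertex_length, det2_neg_right] at hsucc
        rw [hc.phi_eq_abs hk hmod, h, Nat.mod_self, abs_pos]
        omega
      · rw [Nat.mod_eq_of_lt h, hc.phi_eq_abs hk h, hsucc]
        norm_num⟩ h1
  obtain ⟨b, hb⟩ := exists_soleFarthest_of_card_le_one (u := vertex c (k + 1)) hi hS'
    (fun j hj => hc.phi_succ_mod_eq_abs hk hj) ⟨k, hk, by
      rw [hc.phi_succ_mod_eq_abs hk hk, det2_swap, hsucc]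
      norm_num⟩ h2
  refine ⟨_, (hS' _).2 ⟨k, hk, Or.inl rfl⟩, edgeCoord c i (vertex c (k + 1)), (hS' _).2 ?_, a, b,
    ⟨by rw [det2_edgeCoord hi, hsucc], fun x hx => ?_⟩, ha, hb⟩
  -- At the last edge the next vertex is the negative of vertex 0, which is still a root.
  · rcases eq_or_lt_of_le (Nat.succ_le_of_lt hk) with h | h
    · rw [Nat.succ_eq_add_one] at h
      refine ⟨0, by omega, Or.inr ?_⟩
      rw [h, hc.vertex_length, edgeCoord_neg]
    · exact ⟨k + 1, h, Or.inl rfl⟩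
  · obtain ⟨j, hj, rfl | rfl⟩ := (hS' x).1 hx
    · rw [det2_edgeCoord hi, det2_edgeCoord hi]
      exact hc.vertex_mul_vertex_nonneg hk hj
    · rw [← edgeCoord_neg, det2_edgeCoord hi, det2_edgeCoord hi, det2_neg_right, det2_neg_right,
        neg_mul_neg]
      exact hc.vertex_mul_vertex_nonneg hk hj

/-! ### The chamber with a greatest root -/

theorem maximal_iff_eq_of_forall_le {S : Set (Fin 2 → ℤ)} {p : Fin 2 → ℤ} (hp : p ∈ S)
    (h : ∀ q ∈ S, q ≤ p) (q : Fin 2 → ℤ) : Maximal (fun x => x ∈ S) q ↔ q = p := by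
  constructor
  · intro hq
    exact le_antisymm (h q hq.1) (hq.2 hp (h q hq.1))
  · rintro rfl
    exact ⟨hp, fun x hx _ => h x hx⟩

theorem corollary3 {V : Type*} [NormedAddCommGroup V] [NormedSpace ℝ V]
    (R : Set (Module.Dual ℝ V)) (hR : IsCrystallographic 2 R)
    (hR3 : 3 ≤ (hyperplanes R).ncard) :
    ∃ (K : Set V) (α : Module.Basis (Fin 2) ℝ (Module.Dual ℝ V)) (p : Fin 2 → ℤ),
      IsChamber R K ∧ IsBasisAt R K α ∧
      (∀ q : Fin 2 → ℤ, Maximal (fun x => x ∈ rootSystemAt R α) q ↔ q = p) ∧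
      (∀ c : List ℤ, IsEtaSeq c → IsAssociated c R → ¬ IsDense c →
        ∀ q ∈ rootSystemAt R α, q ≠ p → q 0 < p 0 ∧ q 1 < p 1) := by
  -- A single associated sequence that is not dense already gives a chamber with strict
  -- inequalities, and these do not mention the sequence.
  by_cases h : ∃ c, IsEtaSeq c ∧ IsAssociated c R ∧ ¬ IsDense c
  · obtain ⟨c, hc, ⟨K, α, hK, hα, i, hi, hroots⟩, hnd⟩ := h
    obtain ⟨k, hk, k', hk', a, b, hkk, ha, hb⟩ := hc.exists_adj_soleFarthest hi hroots hnd
    obtain ⟨r, hr, s, hs, w, hrs, hrw, hsw⟩ :=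
      (hR.isRootSet hK hα hR3).exists_adj_soleFarthest hk hk' hkk ha hb
    obtain ⟨K', α', hK', hα', hmem⟩ := hR.exists_chamber_rootSystemAt hK hα hr hs hrs
    have hlt : ∀ q ∈ rootSystemAt R α', q ≠ ![det2 r w, det2 s w] →
        q 0 < det2 r w ∧ q 1 < det2 s w := by
      intro q hq hne
      obtain ⟨x, hx, rfl⟩ := (hmem q).1 hq
      have hxw : x ≠ w := by
        rintro rfl
        exact hne rfl
      exact ⟨hrw.2 x hx hxw, hsw.2 x hx hxw⟩
    refine ⟨K', α', ![det2 r w, det2 s w], hK', hα',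
      maximal_iff_eq_of_forall_le ((hmem _).2 ⟨w, hrw.1, rfl⟩) fun q hq => ?_,
      fun _ _ _ _ => hlt⟩
    by_cases hne : q = ![det2 r w, det2 s w]
    · exact hne.le
    · have := hlt q hq hne
      intro k
      fin_cases k
      · exact this.1.le
      · exact this.2.le
  · obtain ⟨K, α, hK, hα⟩ := hR.exists_isBasisAt
    obtain ⟨r, hr, s, hs, w, hrs, hrw, hsw⟩ := (hR.isRootSet hK hα hR3).exists_adj_farthest
    obtain ⟨K', α', hK', hα', hmem⟩ := hR.exists_chamber_rootSystemAt hK hα hr hs hrs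
    refine ⟨K', α', ![det2 r w, det2 s w], hK', hα',
      maximal_iff_eq_of_forall_le ((hmem _).2 ⟨w, hrw.1, rfl⟩) fun q hq => ?_,
      fun c h1 h2 h3 => absurd ⟨c, h1, h2, h3⟩ h⟩
    obtain ⟨x, hx, rfl⟩ := (hmem q).1 hq
    intro k
    fin_cases k
    · exact hrw.2 x hx
    · exact hsw.2 x hx
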